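/- **Setting.** Let $X,Y,Z$ be (real or complex) Hilbert spaces, $A:X\to Y$ and $E:Y\to Z$ bounded linear operators ($E$ plays the role of an embedding $Y\subset Z$, so $v\in Y$ is regarded as the element $Ev$ of $Z$), and put $T:=E^*A$, i.e. $Tf=E^*(E(Af))$. Functions of bounded nonnegative self-adjoint operators are taken in the Borel functional calculus. The data are $y^\delta=Af^\dagger+\delta\zeta\in Z$ (i.e. $E(Af^\dagger)+\delta\zeta$) with $\zeta\in Z$, $\|E^*\zeta\|_Y\le 1$, $\delta\ge 0$; put $g^\delta:=E^*y^\delta$ and $f_\alpha^\delta:=q_\alpha(T^*T)T^*g^\delta$. An *index function* is a continuous non-decreasing $\varphi:[0,\infty)\to[0,\infty)$ with $\varphi(0)=0$ and $\varphi>0$ on $(0,\infty)$. Write $\varphi_1\prec\varphi_2$ if $\varphi_2/\varphi_1$ (with value $0$ at $0$) is an index function. *Regularization.* Let $a\ge\|T^*T\|$, and let $q_\alpha$ ($0<\alpha\le a$) be real Borel functions with $|1-\lambda q_\alpha(\lambda)|\le\gamma$ and $|q_\alpha(\lambda)|\le\gamma_*/\alpha$ for all $0<\lambda,\alpha\le a$,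 and with qualification $\rho:(0,a]\to(0,\infty)$, i.e. $|1-\lambda q_\alpha(\lambda)|\,\rho(\lambda)\le\gamma\rho(\alpha)$ for all $0<\lambda,\alpha\le a$. *Source condition.* $f^\dagger=\varphi(A^*A)w$ with $\|w\|\le 1$, for an index function $\varphi$. *Link condition.* There are an index function $\psi$ and $0<m\le1\le M<\infty$ with $m\|\psi(AA^*)v\|\le\|(EE^*)^{1/2}v\|\le M\|\psi(AA^*)v\|$ for all $v\in Y$, where $(EE^*)^{1/2}$ acts on $Z$ and the middle norm, $\|(EE^*)^{1/2}Ev\|_Z$, equals $\|E^*Ev\|_Y$. Put $\Theta(\lambda):=\sqrt\lambda\,\psi(\lambda)$ and $f_0(t):=\big((\Theta^2)^{-1}(t)\big)^{1/2}$. *Lifting condition* with index $\mu>1$ and constants $0<m'\le1\le M'<\infty$: $(m')^\mu\|\Theta^\mu(A^*A)w\|\le\|(T^*T)^{\mu/2}w\|\le (M')^\mu\|\Theta^\mu(A^*A)w\|$ for all $w\in X$, and $f_0^2$ is operator concave on $[0,\infty)$. **Theorem 1.** Assume the above regularization, noise, source and link conditions, and that $\lambda\mapsto\varphi(f_0^2(\lambda))/\rho(\lambda)$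 is non-increasing on $(0,a]$. 1. If $1\prec\varphi\prec\Theta$, then for all $0<\alpha\le a$ $$\|f^\dagger-f_\alpha^\delta\|_X\le C\Big(\varphi(f_0^2(\alpha))+\frac{\delta}{\sqrt\alpha}\Big),$$ where $C$ depends only on $\gamma,\gamma_*$ and the link constants $m,M$. 2. If the lifting condition holds with an index $\mu>1$ that is large enough that $\Theta\prec\varphi\prec\Theta^\mu$, then the same bound holds for all $0<\alpha\le a$, where $C$ depends only on $\gamma,\gamma_*$ and the lifting data $\mu,m',M'$. -/

import Mathlib

universe u₀ u₁ u₂ u₃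

open scoped MatrixOrder

noncomputable section

/-! ### Functional calculus of a bounded nonnegative self-adjoint operator

The regularization functions are merely Borel (spectral cut-off has a jump) and the Hilbert spaces
may be real or complex, so the Borel functional calculus is set up through spectral measures. -/

section FunctionalCalculus

variable {𝕜 H : Type*} [RCLike 𝕜] [NormedAddCommGroup H] [InnerProductSpace 𝕜 H]

/-- `ν` is the (scalar) spectral measure `B ↦ ⟪x, 1_B(S) x⟫` of the nonnegative self-adjoint
operator `S` at the vector `x`: the finite Borel measure carried by `[0, ‖S‖]` with moments
`⟪x, S ^ n x⟫`.  (Moments determine a measure on a bounded interval, so `ν` is unique.) -/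
structure IsSpectralMeasure (S : H →L[𝕜] H) (x : H) (ν : MeasureTheory.Measure ℝ) : Prop where
  finite : MeasureTheory.IsFiniteMeasure ν
  support : ν (Set.Icc 0 ‖S‖)ᶜ = 0
  moments : ∀ n : ℕ, ∫ t, t ^ n ∂ν = RCLike.re (inner 𝕜 x ((S ^ n) x))

/-- `Q = f(S)`: the bounded operator `Q` is symmetric and `⟪x, Q x⟫ = ∫ f dν_x` for all `x`, where
`ν_x` is the spectral measure of `S` at `x`.  This determines `Q`. -/
structure IsFunctionOf (S : H →L[𝕜] H) (f : ℝ → ℝ) (Q : H →L[𝕜] H) : Prop where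
  symm : ∀ x y : H, inner 𝕜 (Q x) y = inner 𝕜 x (Q y)
  form : ∀ x : H, ∃ ν : MeasureTheory.Measure ℝ, IsSpectralMeasure S x ν ∧
    MeasureTheory.Integrable f ν ∧ RCLike.re (inner 𝕜 x (Q x)) = ∫ t, f t ∂ν

open Classical in
/-- The operator `f(S)` of the Borel functional calculus, for a bounded nonnegative self-adjoint
operator `S` on a Hilbert space and a Borel function `f` that is bounded on `[0, ‖S‖]`
(the value is `0` for arguments that have no `f(S)`). -/
def borelFC (S : H →L[𝕜] H) (f : ℝ → ℝ) : H →L[𝕜] H :=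
  if h : ∃ Q : H →L[𝕜] H, IsFunctionOf S f Q then h.choose else 0

end FunctionalCalculus

/-! ### Index functions -/

/-- An index function `[0, ∞) → [0, ∞)`, represented by a function on `ℝ` of which only the values
on `[0, ∞)` matter. -/
structure IsIndexFunction (f : ℝ → ℝ) : Prop where
  mono : MonotoneOn f (Set.Ici 0)
  cont : ContinuousOn f (Set.Ici 0)
  pos : ∀ t, 0 < t → 0 < f t
  zero : f 0 = 0

/-- `f₁ ≺ f₂`: the quotient `f₂ / f₁` is an index function (with value `0` at `0`). -/
def Prec (f₁ f₂ : ℝ → ℝ) : Prop := IsIndexFunction (fun t => f₂ t / f₁ t)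

/-- `Θ(t) = √t ψ(t)`. -/
def Theta (ψ : ℝ → ℝ) (t : ℝ) : ℝ := Real.sqrt t * ψ t

/-- `f₀(t) = ((Θ²)⁻¹(t))^{1/2}`, where `(Θ²)⁻¹` is the inverse of the bijection `Θ²` of `[0, ∞)`. -/
def f0 (ψ : ℝ → ℝ) (t : ℝ) : ℝ :=
  Real.sqrt (Function.invFunOn (fun l => Theta ψ l ^ 2) (Set.Ici 0) t)

/-- Operator concavity on `[0, ∞)`: concavity, in the Loewner order, of `S ↦ f(S)` on the positive
semidefinite matrices of every size. -/
def IsOperatorConcave (f : ℝ → ℝ) : Prop :=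
  ∀ n : ℕ, ConcaveOn ℝ {S : Matrix (Fin n) (Fin n) ℂ | 0 ≤ S} (fun S => cfc f S)

/-! ### Regularization schemes -/

/-- The Borel functions `q α` form a regularization on `(0, a]` with constants `γ`, `γs`. -/
structure IsRegularization (q : ℝ → ℝ → ℝ) (a γ γs : ℝ) : Prop where
  meas : ∀ α, 0 < α → α ≤ a → Measurable (q α)
  residual : ∀ α, 0 < α → α ≤ a → ∀ t, 0 < t → t ≤ a → |1 - t * q α t| ≤ γ
  bound : ∀ α, 0 < α → α ≤ a → ∀ t, 0 < t → t ≤ a → |q α t| ≤ γs / α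

/-- The positive function `ρ` on `(0, a]` is a qualification of `q`, with constant `γ`. -/
structure HasQualification (q : ℝ → ℝ → ℝ) (ρ : ℝ → ℝ) (a γ : ℝ) : Prop where
  pos : ∀ t, 0 < t → t ≤ a → 0 < ρ t
  bound : ∀ α, 0 < α → α ≤ a → ∀ t, 0 < t → t ≤ a → |1 - t * q α t| * ρ t ≤ γ * ρ α

/-! ### The preprocessed problem -/

section Problem

open ContinuousLinearMap

variable {𝕜 X Y Z : Type*} [RCLike 𝕜]
  [NormedAddCommGroup X] [InnerProductSpace 𝕜 X] [CompleteSpace X]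
  [NormedAddCommGroup Y] [InnerProductSpace 𝕜 Y] [CompleteSpace Y]
  [NormedAddCommGroup Z] [InnerProductSpace 𝕜 Z] [CompleteSpace Z]

/-- `T = E* A : X → Y`.  The embedding `E : Y → Z` is what identifies `A f ∈ Y` with an element of
`Z`, on which `E* : Z → Y` acts. -/
def preOp (A : X →L[𝕜] Y) (E : Y →L[𝕜] Z) : X →L[𝕜] Y :=
  (adjoint E).comp (E.comp A)

/-- The noisy measurement `y^δ = A f + δ ζ`, an element of `Z`. -/
def noisyData (A : X →L[𝕜] Y) (E : Y →L[𝕜] Z) (f : X) (δ : ℝ) (ζ : Z) : Z :=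
  E (A f) + (δ : 𝕜) • ζ

/-- The regularized solution `q_α(T*T) T* g^δ` with `T = E* A` and `g^δ = E* y^δ`. -/
def regSolution (A : X →L[𝕜] Y) (E : Y →L[𝕜] Z) (q : ℝ → ℝ → ℝ) (α : ℝ) (y : Z) : X :=
  borelFC ((adjoint (preOp A E)).comp (preOp A E)) (q α) (adjoint (preOp A E) (adjoint E y))

/-- The source set `{φ(A*A) w : ‖w‖ ≤ 1}`. -/
def sourceSet (A : X →L[𝕜] Y) (φ : ℝ → ℝ) : Set X :=
  {f | ∃ w : X, ‖w‖ ≤ 1 ∧ f = borelFC ((adjoint A).comp A) φ w}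

/-- The link condition `m ‖ψ(AA*) v‖ ≤ ‖(EE*)^{1/2} v‖ ≤ M ‖ψ(AA*) v‖` for `v ∈ Y`.  The operator
`(EE*)^{1/2}` acts on `Z` and is applied to `v` as an element `E v` of `Z`. -/
structure LinkCondition (A : X →L[𝕜] Y) (E : Y →L[𝕜] Z) (ψ : ℝ → ℝ) (m M : ℝ) : Prop where
  index : IsIndexFunction ψ
  m_pos : 0 < m
  m_le : m ≤ 1
  le_M : 1 ≤ M
  lower : ∀ v : Y, m * ‖borelFC (A.comp (adjoint A)) ψ v‖ ≤
    ‖borelFC (E.comp (adjoint E)) Real.sqrt (E v)‖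
  upper : ∀ v : Y, ‖borelFC (E.comp (adjoint E)) Real.sqrt (E v)‖ ≤
    M * ‖borelFC (A.comp (adjoint A)) ψ v‖

/-- The lifting condition
`m^μ ‖Θ^μ(A*A) w‖ ≤ ‖(T*T)^{μ/2} w‖ ≤ M^μ ‖Θ^μ(A*A) w‖` for `w ∈ X`, with lifting index `μ > 1`,
together with operator concavity of `f₀²`. -/
structure LiftingCondition (A : X →L[𝕜] Y) (E : Y →L[𝕜] Z) (ψ : ℝ → ℝ) (μ m M : ℝ) : Prop where
  one_lt : 1 < μ
  m_pos : 0 < m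
  m_le : m ≤ 1
  le_M : 1 ≤ M
  lower : ∀ w : X, m ^ μ * ‖borelFC ((adjoint A).comp A) (fun t => Theta ψ t ^ μ) w‖ ≤
    ‖borelFC ((adjoint (preOp A E)).comp (preOp A E)) (fun t => t ^ (μ / 2)) w‖
  upper : ∀ w : X,
    ‖borelFC ((adjoint (preOp A E)).comp (preOp A E)) (fun t => t ^ (μ / 2)) w‖ ≤
    M ^ μ * ‖borelFC ((adjoint A).comp A) (fun t => Theta ψ t ^ μ) w‖
  concave : IsOperatorConcave (fun t => f0 ψ t ^ 2)

end Problem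

end

/-!
Write `G = A*A`, `T = E*A`, `S = T*T`, `r(t) = 1 - t q_α(t)` and `Φ = φ ∘ f₀²`.  The error is
`r(S) f† - δ q_α(S) T* E*ζ`.  The noise part is at most `δ √(γs (1 + γ)) / √α`, because
`‖T q_α(S) x‖² = ∫ t q_α(t)² dν_x` with `ν_x` the spectral measure of `S` at `x`
(`norm_borelFC_adjoint_apply_le`).  For the other part it suffices, by duality, to bound
`φ(G) r(S)`, and the heart of the matter is the comparison
`‖φ(G) y‖ ≤ (2 / c) ‖Φ(S) y‖` (`norm_borelFC_le_of_prec`): with `y = r(S) x` its right-hand side is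
controlled by the qualification (`abs_residual_mul_le`).

Both regimes reduce to one hypothesis, `c ‖Θ^μ(G) w‖ ≤ ‖S^{μ/2} w‖` for all `w`.  It is the lower
lifting inequality with `c = m^μ` in the second regime.  In the first it holds with `μ = 1` and
`c = m`, since `‖(EE*)^{1/2} E v‖ = ‖E*E v‖` and `ψ(AA*) A = A ψ(A*A)`
(`LinkCondition.le_norm_sqrt`).  The comparison then is real interpolation between the exponents
`0` and `μ`.  The hypothesis compares the `K`-functionals of the two operators, that is, the
integrals of `min(s, Θ^{2μ})` and `min(s, t^μ)` against the spectral measures of `G` and `S` at the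
same vector (`integral_min_sq_le`).  As `φ` and `Θ^μ / φ` are non-decreasing, `φ² = κ(Θ^{2μ})`
with a quasi-concave `κ`, and every quasi-concave function is, up to a factor `2`, a positive
superposition of truncations `min(s, ·)` (`IsQuasiConcave.integral_le`).  Operator concavity of
`f₀²` plays no role in this argument.

The Borel calculus over both scalar fields is built from polynomials.  Spectral measures exist as
cluster points of the eigenvalue distributions of compressions to Krylov spaces
(`exists_isSpectralMeasure`), and `f(S) x` is the limit of `p(S) x` when the polynomials `p` tend
to `f` in `L²(ν_x)` (`isL2Limit_borelFC`).  Choosing one sequence of polynomials for several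
measures at once gives linearity, multiplicativity and the intertwining relation.
-/

noncomputable section

/-! ### Spectral measures of positive operators -/

section SpectralMeasure

open MeasureTheory Polynomial

variable {𝕜 H : Type*} [RCLike 𝕜] [NormedAddCommGroup H] [InnerProductSpace 𝕜 H]

/-- The operator `p(S)` for a real polynomial `p`, over either scalar field. -/
def polyOp (S : H →L[𝕜] H) : ℝ[X] →+* (H →L[𝕜] H) :=
  (Polynomial.aeval S).toRingHom.comp (Polynomial.mapRingHom (algebraMap ℝ 𝕜))

theorem polyOp_X (S : H →L[𝕜] H) : polyOp S X = S := by simp [polyOp]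

theorem polyOp_C_apply (S : H →L[𝕜] H) (c : ℝ) (x : H) : polyOp S (C c) x = (c : 𝕜) • x := by
  simp [polyOp, Algebra.algebraMap_eq_smul_one]

theorem polyOp_monomial_apply (S : H →L[𝕜] H) (n : ℕ) (c : ℝ) (x : H) :
    polyOp S (monomial n c) x = (c : 𝕜) • (S ^ n) x := by
  rw [← C_mul_X_pow_eq_monomial, map_mul, map_pow, polyOp_X]
  exact polyOp_C_apply S c _

theorem inner_polyOp {S : H →L[𝕜] H} (hS : S.IsPositive) (p : ℝ[X]) (x y : H) :
    inner 𝕜 (polyOp S p x) y = inner 𝕜 x (polyOp S p y) := by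
  induction p using Polynomial.induction_on' generalizing x y with
  | add p q hp hq => simp [map_add, inner_add_left, inner_add_right, hp, hq]
  | monomial n c =>
    have key : ∀ x y : H, inner 𝕜 ((S ^ n) x) y = inner 𝕜 x ((S ^ n) y) := by
      induction n with
      | zero => simp
      | succ n ih =>
        intro x y
        rw [pow_succ', mul_apply_eq_comp, hS.inner_left_eq_inner_right, ih,
          ← mul_apply_eq_comp, ← pow_succ, pow_succ']
    rw [polyOp_monomial_apply, polyOp_monomial_apply, inner_smul_left, inner_smul_right, key,
      RCLike.conj_ofReal]

/-- On the Krylov space spanned by `x, S x, …, S ^ d x` the operator `S` compresses to a positive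
matrix whose eigenvalue distribution at `x` (the Gauss quadrature of order `d`) has the right
moments up to order `d`. -/
theorem exists_probabilityMeasure_moments_le {S : H →L[𝕜] H} (hS : S.IsPositive) {x : H}
    (hx : ‖x‖ = 1) (d : ℕ) :
    ∃ ν : ProbabilityMeasure (Set.Icc 0 ‖S‖), ∀ n ≤ d,
      ∫ t, (t : ℝ) ^ n ∂(ν : Measure (Set.Icc 0 ‖S‖)) = RCLike.re (inner 𝕜 x ((S ^ n) x)) := by
  classical
  let V : Submodule 𝕜 H := Submodule.span 𝕜 (Set.range fun i : Fin (d + 1) => (S ^ (i : ℕ)) x)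
  have hmem : ∀ n ≤ d, (S ^ n) x ∈ V := fun n hn =>
    Submodule.subset_span ⟨⟨n, by omega⟩, rfl⟩
  have : FiniteDimensional 𝕜 V := FiniteDimensional.span_of_finite 𝕜 (Set.finite_range _)
  let T : V →L[𝕜] V := V.orthogonalProjectionOnto ∘L S ∘L V.subtypeL
  have hT : T.IsPositive := hS.orthogonalProjectionOnto_comp V
  have hTinner : ∀ v w : V, inner 𝕜 v (T w) = inner 𝕜 (v : H) (S w) := by
    intro v w
    simp [T]
  let v : V := ⟨x, by simpa using hmem 0 (Nat.zero_le d)⟩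
  have hpow : ∀ n ≤ d, (((T ^ n) v : V) : H) = (S ^ n) x := by
    intro n
    induction n with
    | zero => simp [v]
    | succ n ih =>
      intro hn
      have h1 := ih (by omega)
      have h2 : S ((T ^ n) v : V) ∈ V := by
        rw [h1, ← mul_apply_eq_comp, ← pow_succ']
        exact hmem _ hn
      rw [pow_succ', mul_apply_eq_comp, pow_succ', mul_apply_eq_comp, ← h1]
      exact congrArg Subtype.val (V.orthogonalProjectionOnto_mem_subspace_eq_self ⟨_, h2⟩)
  let b := hT.isSymmetric.eigenvectorBasis rfl
  let l := hT.isSymmetric.eigenvalues rfl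
  have hb : ∀ i, T (b i) = (l i : 𝕜) • b i := fun i => hT.isSymmetric.apply_eigenvectorBasis rfl i
  have hbn : ∀ i, ‖b i‖ = 1 := fun i => b.norm_eq_one i
  have hl : ∀ i, l i = RCLike.re (inner 𝕜 (b i : H) (S (b i))) := by
    intro i
    rw [← hTinner, hb, inner_smul_right, inner_self_eq_norm_sq_to_K, hbn]
    simp
  have hlmem : ∀ i, l i ∈ Set.Icc 0 ‖S‖ := by
    intro i
    rw [hl]
    refine ⟨hS.re_inner_nonneg_right _, (RCLike.re_le_norm _).trans ?_⟩
    refine (norm_inner_le_norm _ _).trans ?_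
    have h1 : ‖(b i : H)‖ = 1 := hbn i
    have h2 := S.le_opNorm (b i)
    rw [h1] at h2 ⊢
    linarith
  have hbT : ∀ (n : ℕ) i, inner 𝕜 (b i) ((T ^ n) v) = ((l i : 𝕜)) ^ n * inner 𝕜 (b i) v := by
    intro n i
    induction n with
    | zero => simp
    | succ n ih =>
      rw [pow_succ', mul_apply_eq_comp, ← hT.inner_left_eq_inner_right, hb,
        inner_smul_left, ih]
      simp
      ring
  let μ : Measure (Set.Icc 0 ‖S‖) :=
    ∑ i, ENNReal.ofReal (‖inner 𝕜 (b i) v‖ ^ 2) • Measure.dirac ⟨l i, hlmem i⟩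
  have hμ : IsProbabilityMeasure μ := by
    constructor
    simp only [μ, Measure.coe_finsetSum, Finset.sum_apply, Measure.smul_apply, measure_univ,
      smul_eq_mul, mul_one]
    rw [← ENNReal.ofReal_sum_of_nonneg (fun _ _ => by positivity), b.sum_sq_norm_inner_right]
    have : ‖v‖ = 1 := hx
    simp [this]
  refine ⟨⟨μ, hμ⟩, fun n hn => ?_⟩
  have h1 : ∫ t, (t : ℝ) ^ n ∂μ = ∑ i, ‖inner 𝕜 (b i) v‖ ^ 2 * l i ^ n := by
    simp only [μ]
    rw [integral_finsetSum_measure]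
    · refine Finset.sum_congr rfl fun i _ => ?_
      rw [integral_smul_measure, integral_dirac, ENNReal.toReal_ofReal (by positivity), smul_eq_mul]
    · intro i _
      exact (integrable_dirac (by simp)).smul_measure ENNReal.ofReal_ne_top
  have h2 : inner 𝕜 x ((S ^ n) x) = inner 𝕜 v ((T ^ n) v) := by
    rw [Submodule.coe_inner, hpow n hn]
  change ∫ t, (t : ℝ) ^ n ∂μ = _
  rw [h1, h2, ← b.sum_inner_mul_inner, map_sum]
  refine Finset.sum_congr rfl fun i _ => ?_
  rw [hbT, ← inner_conj_symm v (b i), mul_left_comm, RCLike.conj_mul, ← RCLike.ofReal_pow,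
    ← RCLike.ofReal_pow, ← RCLike.ofReal_mul, RCLike.ofReal_re]
  ring

/-- A positive operator has a spectral measure at every vector: a cluster point of the Gauss
quadratures. -/
theorem exists_isSpectralMeasure {S : H →L[𝕜] H} (hS : S.IsPositive) (x : H) :
    ∃ ν : Measure ℝ, IsSpectralMeasure S x ν := by
  rcases eq_or_ne x 0 with rfl | hx
  · exact ⟨0, ⟨inferInstance, by simp, by simp⟩⟩
  have hx' : ‖x‖ ≠ 0 := norm_ne_zero_iff.2 hx
  set u : H := ((‖x‖⁻¹ : ℝ) : 𝕜) • x with hu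
  have hu1 : ‖u‖ = 1 := by
    rw [hu, norm_smul, RCLike.norm_ofReal, abs_of_nonneg (by positivity), inv_mul_cancel₀ hx']
  choose ν hν using fun d => exists_probabilityMeasure_moments_le hS hu1 d
  obtain ⟨μ, hμ⟩ := exists_clusterPt_of_compactSpace (Filter.map ν Filter.atTop)
  have hmom : ∀ n : ℕ, ∫ t, (t : ℝ) ^ n ∂(μ : Measure (Set.Icc 0 ‖S‖)) =
      RCLike.re (inner 𝕜 u ((S ^ n) u)) := by
    intro n
    let g : C(Set.Icc 0 ‖S‖, ℝ) := ⟨fun t => (t : ℝ) ^ n, by fun_prop⟩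
    have hg : Continuous fun m : ProbabilityMeasure (Set.Icc 0 ‖S‖) =>
        ∫ t, g t ∂(m : Measure (Set.Icc 0 ‖S‖)) :=
      ProbabilityMeasure.continuous_integral_continuousMap g
    have h1 : MapClusterPt _ Filter.atTop _ := MapClusterPt.continuousAt_comp hg.continuousAt hμ
    have h2 : Filter.Tendsto ((fun m : ProbabilityMeasure (Set.Icc 0 ‖S‖) =>
        ∫ t, g t ∂(m : Measure (Set.Icc 0 ‖S‖))) ∘ ν) Filter.atTop
        (nhds (RCLike.re (inner 𝕜 u ((S ^ n) u)))) := by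
      refine tendsto_const_nhds.congr' ?_
      filter_upwards [Filter.eventually_ge_atTop n] with d hd
      exact (hν d n hd).symm
    exact tendsto_nhds_unique' h1.neBot inf_le_left (inf_le_right.trans h2)
  have : IsFiniteMeasure ((μ : Measure (Set.Icc 0 ‖S‖)).map Subtype.val) := inferInstance
  refine ⟨ENNReal.ofReal (‖x‖ ^ 2) • (μ : Measure (Set.Icc 0 ‖S‖)).map Subtype.val, ⟨?_, ?_, ?_⟩⟩
  · exact Measure.smul_finite _ ENNReal.ofReal_ne_top
  · rw [Measure.smul_apply, Measure.map_apply measurable_subtype_coe measurableSet_Icc.compl]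
    simp
  · intro n
    rw [integral_smul_measure, integral_map measurable_subtype_coe.aemeasurable (by fun_prop), hmom,
      hu, map_smul, inner_smul_left, inner_smul_right, ENNReal.toReal_ofReal (by positivity)]
    simp only [RCLike.conj_ofReal, ← mul_assoc, ← RCLike.ofReal_mul, RCLike.re_ofReal_mul,
      smul_eq_mul]
    field_simp

end SpectralMeasure

/-! ### Bounded Borel functions on the spectral interval -/

section BoundedBorel

open MeasureTheory Polynomial Filter Topology

/-- `f` agrees on `[0, N]` with a bounded Borel function.  The behaviour of `f` off `[0, N]`, which
no spectral measure sees, is left free. -/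
def IsBddBorelOn (N : ℝ) (f : ℝ → ℝ) : Prop :=
  ∃ g : ℝ → ℝ, Measurable g ∧ (∃ C, ∀ t, |g t| ≤ C) ∧ Set.EqOn f g (Set.Icc 0 N)

variable {N : ℝ} {f g : ℝ → ℝ}

theorem IsBddBorelOn.congr (hf : IsBddBorelOn N f) (h : Set.EqOn g f (Set.Icc 0 N)) :
    IsBddBorelOn N g := by
  obtain ⟨f', hm, hb, he⟩ := hf
  exact ⟨f', hm, hb, h.trans he⟩

theorem IsBddBorelOn.mono {N' : ℝ} (hf : IsBddBorelOn N f) (h : N' ≤ N) : IsBddBorelOn N' f := by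
  obtain ⟨f', hm, hb, he⟩ := hf
  exact ⟨f', hm, hb, he.mono (Set.Icc_subset_Icc_right h)⟩

theorem IsBddBorelOn.mul (hf : IsBddBorelOn N f) (hg : IsBddBorelOn N g) :
    IsBddBorelOn N (fun t => f t * g t) := by
  obtain ⟨f', hfm, ⟨C, hC⟩, hfe⟩ := hf
  obtain ⟨g', hgm, ⟨D, hD⟩, hge⟩ := hg
  refine ⟨fun t => f' t * g' t, hfm.mul hgm, ⟨C * D, fun t => ?_⟩, fun t ht => ?_⟩
  · rw [abs_mul]
    exact mul_le_mul (hC t) (hD t) (abs_nonneg _) ((abs_nonneg _).trans (hC t))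
  · simp [hfe ht, hge ht]

theorem IsBddBorelOn.sub (hf : IsBddBorelOn N f) (hg : IsBddBorelOn N g) :
    IsBddBorelOn N (fun t => f t - g t) := by
  obtain ⟨f', hfm, ⟨C, hC⟩, hfe⟩ := hf
  obtain ⟨g', hgm, ⟨D, hD⟩, hge⟩ := hg
  refine ⟨fun t => f' t - g' t, hfm.sub hgm, ⟨C + D, fun t => ?_⟩, fun t ht => ?_⟩
  · exact (abs_sub _ _).trans (add_le_add (hC t) (hD t))
  · simp [hfe ht, hge ht]

theorem IsBddBorelOn.sq (hf : IsBddBorelOn N f) : IsBddBorelOn N (fun t => f t ^ 2) := by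
  simpa only [pow_two] using hf.mul hf

theorem IsBddBorelOn.min (hf : IsBddBorelOn N f) (hg : IsBddBorelOn N g) :
    IsBddBorelOn N (fun t => min (f t) (g t)) := by
  obtain ⟨f', hfm, ⟨C, hC⟩, hfe⟩ := hf
  obtain ⟨g', hgm, ⟨D, hD⟩, hge⟩ := hg
  refine ⟨fun t => Min.min (f' t) (g' t), hfm.min hgm, ⟨Max.max C D, fun t => ?_⟩, fun t ht => ?_⟩
  · exact abs_min_le_max_abs_abs.trans (max_le_max (hC t) (hD t))
  · simp [hfe ht, hge ht]

theorem IsBddBorelOn.of_measurable (hf : Measurable f) (C : ℝ)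
    (h : ∀ t ∈ Set.Icc 0 N, |f t| ≤ C) : IsBddBorelOn N f := by
  refine ⟨(Set.Icc 0 N).indicator f, hf.indicator measurableSet_Icc, ⟨max C 0, fun t => ?_⟩,
    fun t ht => (Set.indicator_of_mem ht f).symm⟩
  by_cases ht : t ∈ Set.Icc 0 N
  · rw [Set.indicator_of_mem ht]
    exact (h t ht).trans (le_max_left _ _)
  · rw [Set.indicator_of_notMem ht, abs_zero]
    exact le_max_right _ _

theorem IsBddBorelOn.const (c : ℝ) : IsBddBorelOn N (fun _ => c) :=
  .of_measurable measurable_const |c| fun _ _ => le_rfl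

theorem IsBddBorelOn.of_continuousOn (hf : ContinuousOn f (Set.Icc 0 N)) : IsBddBorelOn N f := by
  obtain ⟨C, hC⟩ := isCompact_Icc.exists_bound_of_continuousOn hf
  refine IsBddBorelOn.congr (.of_measurable (f := (Set.Icc 0 N).indicator f) ?_ C ?_)
    fun t ht => (Set.indicator_of_mem ht f).symm
  · classical
    rw [← Set.piecewise_eq_indicator]
    exact hf.measurable_piecewise continuousOn_const measurableSet_Icc
  · intro t ht
    rw [Set.indicator_of_mem ht]
    exact hC t ht

theorem IsBddBorelOn.of_monotoneOn (hf : MonotoneOn f (Set.Ici 0)) : IsBddBorelOn N f := by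
  have hm : Monotone fun t => f (max t 0) := fun s t h =>
    hf (Set.mem_Ici.2 (le_max_right _ _)) (Set.mem_Ici.2 (le_max_right _ _)) (max_le_max_right 0 h)
  refine IsBddBorelOn.congr (.of_measurable hm.measurable (max |f 0| |f (max N 0)|) ?_)
    fun t ht => by simp [max_eq_left ht.1]
  intro t ht
  refine abs_le_max_abs_abs ?_ ?_
  · exact hf Set.self_mem_Ici (Set.mem_Ici.2 (le_max_right _ _)) (le_max_right _ _)
  · exact hm ht.2

theorem IsBddBorelOn.eval (p : ℝ[X]) : IsBddBorelOn N (fun t => p.eval t) :=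
  .of_continuousOn p.continuous.continuousOn

variable {ν : Measure ℝ}

theorem IsBddBorelOn.exists_bound (hf : IsBddBorelOn N f) :
    ∃ C, 0 ≤ C ∧ ∀ t ∈ Set.Icc 0 N, |f t| ≤ C := by
  obtain ⟨g, -, ⟨C, hC⟩, he⟩ := hf
  exact ⟨C, (abs_nonneg _).trans (hC 0), fun t ht => by rw [he ht]; exact hC t⟩

theorem IsBddBorelOn.aestronglyMeasurable (hf : IsBddBorelOn N f)
    (hν : ∀ᵐ t ∂ν, t ∈ Set.Icc 0 N) : AEStronglyMeasurable f ν := by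
  obtain ⟨g, hg, -, he⟩ := hf
  exact ⟨g, hg.stronglyMeasurable, hν.mono fun t ht => he ht⟩

theorem IsBddBorelOn.integrable [IsFiniteMeasure ν] (hf : IsBddBorelOn N f) (hν : ∀ᵐ t ∂ν, t ∈ Set.Icc 0 N) :
    Integrable f ν := by
  obtain ⟨C, -, hC⟩ := hf.exists_bound
  exact Integrable.of_bound (hf.aestronglyMeasurable hν) C (hν.mono fun t ht => hC t ht)

theorem integral_sub_sq_le [IsFiniteMeasure ν] {h : ℝ → ℝ} (hf : IsBddBorelOn N f) (hg : IsBddBorelOn N g)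
    (hh : IsBddBorelOn N h) (hν : ∀ᵐ t ∂ν, t ∈ Set.Icc 0 N) :
    ∫ t, (g t - h t) ^ 2 ∂ν ≤ 2 * ∫ t, (f t - g t) ^ 2 ∂ν + 2 * ∫ t, (f t - h t) ^ 2 ∂ν := by
  rw [← integral_const_mul, ← integral_const_mul,
    ← integral_add (((hf.sub hg).sq.integrable hν).const_mul 2)
      (((hf.sub hh).sq.integrable hν).const_mul 2)]
  refine integral_mono ((hg.sub hh).sq.integrable hν)
    ((((hf.sub hg).sq.integrable hν).const_mul 2).add
      (((hf.sub hh).sq.integrable hν).const_mul 2)) fun t => ?_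
  simp only
  nlinarith [sq_nonneg ((f t - g t) + (f t - h t))]

/-- Polynomials are dense in `L²` of a finite measure on a bounded interval. -/
theorem exists_poly_integral_sq_le [IsFiniteMeasure ν] (hf : IsBddBorelOn N f) (hν : ∀ᵐ t ∂ν, t ∈ Set.Icc 0 N)
    {ε : ℝ} (hε : 0 < ε) : ∃ p : ℝ[X], ∫ t, (f t - p.eval t) ^ 2 ∂ν ≤ ε := by
  obtain ⟨C, -, hC⟩ := hf.exists_bound
  have hL : MemLp f (ENNReal.ofReal 2) ν :=
    MemLp.of_bound (hf.aestronglyMeasurable hν) C (hν.mono fun t ht => hC t ht)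
  obtain ⟨g, hg, -⟩ := hL.exists_boundedContinuous_integral_rpow_sub_le (p := 2) two_pos
    (show 0 < ε / 4 by positivity)
  have hg' : ∫ t, (f t - g t) ^ 2 ∂ν ≤ ε / 4 := by
    simpa only [Real.rpow_two, Real.norm_eq_abs, sq_abs] using hg
  set m := ν.real Set.univ with hm
  have hm0 : 0 ≤ m := measureReal_nonneg
  set η := Real.sqrt (ε / (4 * (m + 1))) with hη
  have hη2 : η ^ 2 = ε / (4 * (m + 1)) := Real.sq_sqrt (by positivity)
  obtain ⟨p, hp⟩ := exists_polynomial_near_of_continuousOn 0 N g g.continuous.continuousOn η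
    (Real.sqrt_pos.2 (by positivity))
  refine ⟨p, ?_⟩
  have hgB : IsBddBorelOn N g := .of_continuousOn g.continuous.continuousOn
  have h1 : ∫ t, (g t - p.eval t) ^ 2 ∂ν ≤ ε / 4 := by
    calc ∫ t, (g t - p.eval t) ^ 2 ∂ν ≤ ∫ _, η ^ 2 ∂ν := by
          refine integral_mono_ae ((hgB.sub (.eval p)).sq.integrable hν) (integrable_const _) ?_
          filter_upwards [hν] with t ht
          rw [← sq_abs, abs_sub_comm]
          exact pow_le_pow_left₀ (abs_nonneg _) (hp t ht).le 2
      _ = m * (ε / (4 * (m + 1))) := by rw [integral_const, hη2, smul_eq_mul]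
      _ ≤ ε / 4 := by
          rw [mul_div_assoc', div_le_div_iff₀ (by positivity) (by positivity)]
          nlinarith
  have h2 := integral_sub_sq_le (ν := ν) hgB hf (.eval p) hν
  have h3 : ∫ t, (g t - f t) ^ 2 ∂ν = ∫ t, (f t - g t) ^ 2 ∂ν :=
    integral_congr_ae (Eventually.of_forall fun t => by simp only; ring)
  linarith

/-- One sequence of polynomials converges to `f` in `L²` of finitely many measures at once. -/
theorem exists_poly_seq_tendsto {ι : Type*} [Fintype ι] (hf : IsBddBorelOn N f)
    (ν : ι → Measure ℝ) (hfin : ∀ i, IsFiniteMeasure (ν i))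
    (hν : ∀ i, ∀ᵐ t ∂(ν i), t ∈ Set.Icc 0 N) :
    ∃ p : ℕ → ℝ[X], ∀ i, Tendsto (fun n => ∫ t, (f t - (p n).eval t) ^ 2 ∂(ν i)) atTop (𝓝 0) := by
  have hs : ∀ᵐ t ∂(Measure.sum ν), t ∈ Set.Icc 0 N := Measure.ae_sum_iff.2 hν
  have : IsFiniteMeasure (Measure.sum ν) := by
    rw [Measure.sum_fintype]; infer_instance
  choose p hp using fun n : ℕ =>
    exists_poly_integral_sq_le hf hs (show (0 : ℝ) < 1 / ((n : ℝ) + 1) by positivity)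
  refine ⟨p, fun i => squeeze_zero (fun n => integral_nonneg fun t => sq_nonneg _) (fun n => ?_)
    tendsto_one_div_add_atTop_nhds_zero_nat⟩
  refine (integral_mono_measure (Measure.le_sum ν i) (Eventually.of_forall fun t => sq_nonneg _)
    ((hf.sub (.eval _)).sq.integrable hs)).trans (hp n)

theorem sq_integral_le [IsFiniteMeasure ν] (hf : IsBddBorelOn N f) (hν : ∀ᵐ t ∂ν, t ∈ Set.Icc 0 N) :
    (∫ t, f t ∂ν) ^ 2 ≤ (ν.real Set.univ + 1) * ∫ t, f t ^ 2 ∂ν := by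
  set m := ν.real Set.univ with hm
  have hm0 : 0 ≤ m := measureReal_nonneg
  set I := ∫ t, f t ∂ν with hI
  have h0 : 0 ≤ ∫ t, (f t - I / (m + 1)) ^ 2 ∂ν := integral_nonneg fun t => sq_nonneg _
  have h1 : ∫ t, (f t - I / (m + 1)) ^ 2 ∂ν =
      ∫ t, f t ^ 2 ∂ν - 2 * (I / (m + 1)) * I + (I / (m + 1)) ^ 2 * m := by
    have : ∀ t, (f t - I / (m + 1)) ^ 2 =
        f t ^ 2 - 2 * (I / (m + 1)) * f t + (I / (m + 1)) ^ 2 := fun t => by ring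
    simp_rw [this]
    have i1 := hf.sq.integrable hν
    have i2 := (hf.integrable hν).const_mul (2 * (I / (m + 1)))
    have i3 : Integrable (fun t => f t ^ 2 - 2 * (I / (m + 1)) * f t) ν := i1.sub i2
    rw [integral_add i3 (integrable_const _), integral_sub i1 i2,
      integral_const_mul, integral_const, smul_eq_mul, mul_comm _ ((I / (m + 1)) ^ 2)]
  have h2 : I = I / (m + 1) * (m + 1) := by field_simp
  set c := I / (m + 1)
  rw [h1] at h0
  rw [h2] at h0 ⊢
  nlinarith [sq_nonneg c]

theorem tendsto_integral_of_integral_sub_sq [IsFiniteMeasure ν] {p : ℕ → ℝ[X]} (hf : IsBddBorelOn N f)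
    (hν : ∀ᵐ t ∂ν, t ∈ Set.Icc 0 N)
    (hp : Tendsto (fun n => ∫ t, (f t - (p n).eval t) ^ 2 ∂ν) atTop (𝓝 0)) :
    Tendsto (fun n => ∫ t, (p n).eval t ∂ν) atTop (𝓝 (∫ t, f t ∂ν)) := by
  rw [tendsto_iff_dist_tendsto_zero]
  have h1 : Tendsto (fun n => Real.sqrt ((ν.real Set.univ + 1) *
      ∫ t, (f t - (p n).eval t) ^ 2 ∂ν)) atTop (𝓝 0) := by
    have := (hp.const_mul (ν.real Set.univ + 1)).sqrt
    simpa using this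
  refine squeeze_zero (fun _ => dist_nonneg) (fun n => ?_) h1
  refine Real.le_sqrt_of_sq_le ?_
  rw [dist_comm, Real.dist_eq, sq_abs,
    ← integral_sub (hf.integrable hν) ((IsBddBorelOn.eval (p n)).integrable hν)]
  exact sq_integral_le (hf.sub (.eval (p n))) hν

end BoundedBorel

/-! ### The Borel functional calculus -/

section BorelCalculus

open MeasureTheory Polynomial Filter Topology

variable {𝕜 H : Type*} [RCLike 𝕜] [NormedAddCommGroup H] [InnerProductSpace 𝕜 H]
  {S : H →L[𝕜] H} {x : H} {ν : Measure ℝ} {f g : ℝ → ℝ}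

theorem IsSpectralMeasure.ae_mem (h : IsSpectralMeasure S x ν) :
    ∀ᵐ t ∂ν, t ∈ Set.Icc 0 ‖S‖ := h.support

theorem IsSpectralMeasure.integral_eval (h : IsSpectralMeasure S x ν) (p : ℝ[X]) :
    ∫ t, p.eval t ∂ν = RCLike.re (inner 𝕜 x (polyOp S p x)) := by
  have := h.finite
  induction p using Polynomial.induction_on' with
  | add p q hp hq =>
    have i1 : Integrable (fun t => p.eval t) ν := (IsBddBorelOn.eval p).integrable h.ae_mem
    have i2 : Integrable (fun t => q.eval t) ν := (IsBddBorelOn.eval q).integrable h.ae_mem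
    simp only [eval_add, map_add, add_apply, inner_add_right]
    rw [integral_add i1 i2, hp, hq]
  | monomial n c =>
    simp only [eval_monomial]
    rw [integral_const_mul, h.moments, polyOp_monomial_apply, inner_smul_right,
      RCLike.re_ofReal_mul]

theorem IsSpectralMeasure.norm_polyOp_sq (hS : S.IsPositive) (h : IsSpectralMeasure S x ν)
    (p : ℝ[X]) : ‖polyOp S p x‖ ^ 2 = ∫ t, p.eval t ^ 2 ∂ν := by
  have h1 := h.integral_eval (p * p)
  rw [map_mul, mul_apply_eq_comp, ← inner_polyOp hS, inner_self_eq_norm_sq] at h1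
  rw [← h1]
  simp only [eval_mul, pow_two]

theorem IsSpectralMeasure.measureReal_univ (h : IsSpectralMeasure S x ν) :
    ν.real Set.univ = ‖x‖ ^ 2 := by
  have := h.moments 0
  simpa [inner_self_eq_norm_sq] using this

/-- Moments determine a measure on a bounded interval. -/
theorem IsSpectralMeasure.unique {ν' : Measure ℝ} (h : IsSpectralMeasure S x ν)
    (h' : IsSpectralMeasure S x ν') : ν = ν' := by
  have := h.finite
  have := h'.finite
  have key : ∀ (ν : Measure ℝ) (_ : IsSpectralMeasure S x ν) (g : BoundedContinuousFunction ℝ ℝ)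
      (p : ℝ[X]) (ε : ℝ), (∀ t ∈ Set.Icc 0 ‖S‖, |p.eval t - g t| < ε) →
      |RCLike.re (inner 𝕜 x (polyOp S p x)) - ∫ t, g t ∂ν| ≤ ε * ‖x‖ ^ 2 := by
    intro ν h g p ε hp
    have := h.finite
    have i1 : Integrable (fun t => p.eval t) ν := (IsBddBorelOn.eval p).integrable h.ae_mem
    have i2 : Integrable (fun t => g t) ν := g.integrable ν
    rw [← h.integral_eval, ← integral_sub i1 i2, ← Real.norm_eq_abs, ← h.measureReal_univ]
    exact norm_integral_le_of_norm_le_const (h.ae_mem.mono fun t ht => (hp t ht).le)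
  refine ext_of_forall_integral_eq_of_IsFiniteMeasure fun g => ?_
  refine eq_of_forall_dist_le fun ε hε => ?_
  obtain ⟨p, hp⟩ := exists_polynomial_near_of_continuousOn 0 ‖S‖ g g.continuous.continuousOn
    (ε / (2 * (‖x‖ ^ 2 + 1))) (by positivity)
  have h1 := key ν h g p _ hp
  have h2 := key ν' h' g p _ hp
  have h3 : ε / (2 * (‖x‖ ^ 2 + 1)) * ‖x‖ ^ 2 ≤ ε / 2 := by
    rw [div_mul_eq_mul_div, div_le_div_iff₀ (by positivity) two_pos]
    nlinarith
  rw [Real.dist_eq]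
  rw [abs_le] at h1 h2 ⊢
  constructor <;> linarith [h1.1, h1.2, h2.1, h2.2]

/-- `Q = f(S)` as a strong limit: `p n (S) x` tends to `Q x` whenever the polynomials `p n` tend to
`f` in `L²` of the spectral measure of `S` at `x`. -/
def IsL2Limit (S : H →L[𝕜] H) (f : ℝ → ℝ) (Q : H →L[𝕜] H) : Prop :=
  ∀ (x : H) (ν : Measure ℝ), IsSpectralMeasure S x ν → ∀ p : ℕ → ℝ[X],
    Tendsto (fun n => ∫ t, (f t - (p n).eval t) ^ 2 ∂ν) atTop (𝓝 0) →
      Tendsto (fun n => polyOp S (p n) x) atTop (𝓝 (Q x))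

theorem IsSpectralMeasure.dist_polyOp_le (hS : S.IsPositive) (h : IsSpectralMeasure S x ν)
    (hf : IsBddBorelOn ‖S‖ f) (p q : ℝ[X]) :
    dist (polyOp S p x) (polyOp S q x) ≤ Real.sqrt
      (2 * ∫ t, (f t - p.eval t) ^ 2 ∂ν + 2 * ∫ t, (f t - q.eval t) ^ 2 ∂ν) := by
  have := h.finite
  refine Real.le_sqrt_of_sq_le ?_
  rw [dist_eq_norm, ← sub_apply, ← map_sub, h.norm_polyOp_sq hS]
  simp only [eval_sub]
  exact integral_sub_sq_le hf (.eval p) (.eval q) h.ae_mem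

theorem IsSpectralMeasure.exists_limit [CompleteSpace H] (hS : S.IsPositive)
    (h : IsSpectralMeasure S x ν) (hf : IsBddBorelOn ‖S‖ f) :
    ∃ v : H, ∀ p : ℕ → ℝ[X],
      Tendsto (fun n => ∫ t, (f t - (p n).eval t) ^ 2 ∂ν) atTop (𝓝 0) →
        Tendsto (fun n => polyOp S (p n) x) atTop (𝓝 v) := by
  obtain ⟨p, hp⟩ := exists_poly_seq_tendsto hf (fun _ : Unit => ν) (fun _ => h.finite)
    (fun _ => h.ae_mem)
  replace hp := hp ()
  have hc : CauchySeq fun n => polyOp S (p n) x := by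
    rw [cauchySeq_iff_tendsto_dist_atTop_0]
    refine squeeze_zero (fun _ => dist_nonneg)
      (fun n => h.dist_polyOp_le hS hf (p n.1) (p n.2)) ?_
    rw [← prod_atTop_atTop_eq]
    have h1 := (hp.comp (tendsto_fst (f := atTop) (g := (atTop : Filter ℕ)))).const_mul 2
    have h2 := (hp.comp (tendsto_snd (f := (atTop : Filter ℕ)) (g := atTop))).const_mul 2
    simpa using (h1.add h2).sqrt
  obtain ⟨v, hv⟩ := cauchySeq_tendsto_of_complete hc
  refine ⟨v, fun r hr => ?_⟩
  refine hv.congr_dist (squeeze_zero (fun _ => dist_nonneg)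
    (fun n => h.dist_polyOp_le hS hf (p n) (r n)) ?_)
  have := ((hp.const_mul 2).add (hr.const_mul 2)).sqrt
  simpa using this

theorem norm_limit_sq_le (hS : S.IsPositive) (h : IsSpectralMeasure S x ν)
    (hf : IsBddBorelOn ‖S‖ f) {p : ℕ → ℝ[X]} {v : H}
    (hp : Tendsto (fun n => ∫ t, (f t - (p n).eval t) ^ 2 ∂ν) atTop (𝓝 0))
    (hv : Tendsto (fun n => polyOp S (p n) x) atTop (𝓝 v)) :
    ‖v‖ ^ 2 ≤ 2 * ∫ t, f t ^ 2 ∂ν := by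
  have := h.finite
  have h1 : Tendsto (fun n => 2 * ∫ t, f t ^ 2 ∂ν + 2 * ∫ t, (f t - (p n).eval t) ^ 2 ∂ν) atTop
      (𝓝 (2 * ∫ t, f t ^ 2 ∂ν)) := by
    simpa using (hp.const_mul 2).const_add (2 * ∫ t, f t ^ 2 ∂ν)
  refine le_of_tendsto_of_tendsto' (hv.norm.pow 2) h1 fun n => ?_
  rw [h.norm_polyOp_sq hS]
  have := integral_sub_sq_le (ν := ν) hf (.const 0) (.eval (p n)) h.ae_mem
  simpa using this

/-- Strong limits of polynomials of `S` define the operator `f(S)`. -/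
theorem exists_isL2Limit [CompleteSpace H] (hS : S.IsPositive) (hf : IsBddBorelOn ‖S‖ f) :
    ∃ Q : H →L[𝕜] H, IsL2Limit S f Q := by
  choose ν hν using fun x => exists_isSpectralMeasure hS x
  choose v hv using fun x => (hν x).exists_limit hS hf
  have hadd : ∀ x y, v (x + y) = v x + v y := by
    intro x y
    obtain ⟨p, hp⟩ := exists_poly_seq_tendsto hf ![ν (x + y), ν x, ν y]
      (by intro i; fin_cases i; exacts [(hν _).finite, (hν _).finite, (hν _).finite])
      (by intro i; fin_cases i; exacts [(hν _).ae_mem, (hν _).ae_mem, (hν _).ae_mem])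
    have h1 := hv (x + y) p (hp 0)
    have h2 := (hv x p (hp 1)).add (hv y p (hp 2))
    simp only [← map_add] at h2
    exact tendsto_nhds_unique h1 h2
  have hsmul : ∀ (c : 𝕜) x, v (c • x) = c • v x := by
    intro c x
    obtain ⟨p, hp⟩ := exists_poly_seq_tendsto hf ![ν (c • x), ν x]
      (by intro i; fin_cases i; exacts [(hν _).finite, (hν _).finite])
      (by intro i; fin_cases i; exacts [(hν _).ae_mem, (hν _).ae_mem])
    have h1 := hv (c • x) p (hp 0)
    have h2 := (hv x p (hp 1)).const_smul c
    simp only [← map_smul] at h2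
    exact tendsto_nhds_unique h1 h2
  obtain ⟨C, hC0, hC⟩ := hf.exists_bound
  refine ⟨LinearMap.mkContinuous ⟨⟨v, hadd⟩, hsmul⟩ (2 * C) fun x => ?_, ?_⟩
  · have := (hν x).finite
    obtain ⟨p, hp⟩ := exists_poly_seq_tendsto hf (fun _ : Unit => ν x) (fun _ => (hν x).finite)
      (fun _ => (hν x).ae_mem)
    have h1 := norm_limit_sq_le hS (hν x) hf (hp ()) (hv x p (hp ()))
    have h2 : ∫ t, f t ^ 2 ∂(ν x) ≤ C ^ 2 * ‖x‖ ^ 2 := by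
      calc ∫ t, f t ^ 2 ∂(ν x) ≤ ∫ _, C ^ 2 ∂(ν x) := by
            refine integral_mono_ae (hf.sq.integrable (hν x).ae_mem) (integrable_const _) ?_
            filter_upwards [(hν x).ae_mem] with t ht
            rw [← sq_abs]
            exact pow_le_pow_left₀ (abs_nonneg _) (hC t ht) 2
        _ = C ^ 2 * ‖x‖ ^ 2 := by
            rw [integral_const, (hν x).measureReal_univ, smul_eq_mul, mul_comm]
    refine (pow_le_pow_iff_left₀ (norm_nonneg _) (by positivity) two_ne_zero).1 ?_
    change ‖v x‖ ^ 2 ≤ _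
    nlinarith [mul_nonneg (sq_nonneg C) (sq_nonneg ‖x‖)]
  · intro x ν' h' p hp
    rw [h'.unique (hν x)] at hp
    exact hv x p hp

variable {Q R : H →L[𝕜] H}

theorem IsL2Limit.norm_sq_le (hS : S.IsPositive) (hQ : IsL2Limit S f Q)
    (hf : IsBddBorelOn ‖S‖ f) (h : IsSpectralMeasure S x ν) :
    ‖Q x‖ ^ 2 ≤ 2 * ∫ t, f t ^ 2 ∂ν := by
  obtain ⟨p, hp⟩ := exists_poly_seq_tendsto hf (fun _ : Unit => ν) (fun _ => h.finite)
      (fun _ => h.ae_mem)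
  exact norm_limit_sq_le hS h hf (hp ()) (hQ x ν h p (hp ()))

theorem IsL2Limit.isFunctionOf (hS : S.IsPositive) (hQ : IsL2Limit S f Q)
    (hf : IsBddBorelOn ‖S‖ f) : IsFunctionOf S f Q := by
  constructor
  · intro x y
    obtain ⟨νx, hx⟩ := exists_isSpectralMeasure hS x
    obtain ⟨νy, hy⟩ := exists_isSpectralMeasure hS y
    obtain ⟨p, hp⟩ := exists_poly_seq_tendsto hf ![νx, νy]
      (by intro i; fin_cases i; exacts [hx.finite, hy.finite])
      (by intro i; fin_cases i; exacts [hx.ae_mem, hy.ae_mem])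
    have h1 := (hQ x νx hx p (hp 0)).inner (𝕜 := 𝕜) (tendsto_const_nhds (x := y))
    have h2 := (tendsto_const_nhds (x := x)).inner (𝕜 := 𝕜) (hQ y νy hy p (hp 1))
    simp only [inner_polyOp hS] at h1
    exact tendsto_nhds_unique h1 h2
  · intro x
    obtain ⟨ν, h⟩ := exists_isSpectralMeasure hS x
    have := h.finite
    refine ⟨ν, h, hf.integrable h.ae_mem, ?_⟩
    obtain ⟨p, hp⟩ := exists_poly_seq_tendsto hf (fun _ : Unit => ν) (fun _ => h.finite)
      (fun _ => h.ae_mem)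
    have h1 := tendsto_integral_of_integral_sub_sq hf h.ae_mem (hp ())
    have h2 := (tendsto_const_nhds (x := x)).inner (𝕜 := 𝕜) (hQ x ν h p (hp ()))
    have h3 := (RCLike.continuous_re.tendsto _).comp h2
    refine tendsto_nhds_unique h3 (h1.congr fun n => ?_)
    exact h.integral_eval (p n)

theorem IsFunctionOf.unique (hQ : IsFunctionOf S f Q) (hR : IsFunctionOf S f R) : Q = R := by
  have hsymm : ((Q - R : H →L[𝕜] H) : H →ₗ[𝕜] H).IsSymmetric := by
    intro x y
    simp [inner_sub_left, inner_sub_right, hQ.symm, hR.symm]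
  have hz : ((Q - R : H →L[𝕜] H) : H →ₗ[𝕜] H) = 0 := by
    refine hsymm.inner_map_self_eq_zero.1 fun x => ?_
    obtain ⟨ν, hν, -, h1⟩ := hQ.form x
    obtain ⟨ν', hν', -, h2⟩ := hR.form x
    obtain rfl := hν.unique hν'
    rw [← hsymm.coe_re_inner_apply_self]
    have : RCLike.re (inner 𝕜 x (Q x)) = RCLike.re (inner 𝕜 x (R x)) := h1.trans h2.symm
    rw [hsymm x x]
    simp [inner_sub_right, this]
  rw [← sub_eq_zero]
  ext x
  exact congrArg (fun L : H →ₗ[𝕜] H => L x) hz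

variable [CompleteSpace H]

theorem isL2Limit_borelFC (hS : S.IsPositive) (hf : IsBddBorelOn ‖S‖ f) :
    IsL2Limit S f (borelFC S f) := by
  obtain ⟨Q, hQ⟩ := exists_isL2Limit hS hf
  have h : ∃ Q : H →L[𝕜] H, IsFunctionOf S f Q := ⟨Q, hQ.isFunctionOf hS hf⟩
  have h1 : borelFC S f = h.choose := by rw [borelFC, dif_pos h]
  rw [h1, h.choose_spec.unique (hQ.isFunctionOf hS hf)]
  exact hQ

theorem inner_borelFC (hS : S.IsPositive) (hf : IsBddBorelOn ‖S‖ f) (x y : H) :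
    inner 𝕜 (borelFC S f x) y = inner 𝕜 x (borelFC S f y) :=
  ((isL2Limit_borelFC hS hf).isFunctionOf hS hf).symm x y

theorem adjoint_borelFC (hS : S.IsPositive) (hf : IsBddBorelOn ‖S‖ f) :
    ContinuousLinearMap.adjoint (borelFC S f) = borelFC S f :=
  (ContinuousLinearMap.eq_adjoint_iff _ _).2 (inner_borelFC hS hf) |>.symm

theorem re_inner_borelFC (hS : S.IsPositive) (hf : IsBddBorelOn ‖S‖ f)
    (h : IsSpectralMeasure S x ν) :
    RCLike.re (inner 𝕜 x (borelFC S f x)) = ∫ t, f t ∂ν := by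
  obtain ⟨ν', h', -, h2⟩ := ((isL2Limit_borelFC hS hf).isFunctionOf hS hf).form x
  rw [h.unique h', h2]

theorem borelFC_eval (hS : S.IsPositive) (p : ℝ[X]) :
    borelFC S (fun t => p.eval t) = polyOp S p := by
  ext x
  obtain ⟨ν, h⟩ := exists_isSpectralMeasure hS x
  exact tendsto_nhds_unique (isL2Limit_borelFC hS (.eval p) x ν h (fun _ => p) (by simp))
    tendsto_const_nhds

theorem borelFC_id (hS : S.IsPositive) : borelFC S (fun t => t) = S := by
  simpa [polyOp_X] using borelFC_eval hS X

theorem borelFC_one (hS : S.IsPositive) : borelFC S (fun _ => 1) = 1 := by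
  simpa using borelFC_eval hS 1

theorem borelFC_sub (hS : S.IsPositive) (hf : IsBddBorelOn ‖S‖ f) (hg : IsBddBorelOn ‖S‖ g) :
    borelFC S (fun t => f t - g t) = borelFC S f - borelFC S g := by
  ext x
  obtain ⟨ν, h⟩ := exists_isSpectralMeasure hS x
  have := h.finite
  obtain ⟨p, hp⟩ := exists_poly_seq_tendsto hf (fun _ : Unit => ν) (fun _ => h.finite)
    (fun _ => h.ae_mem)
  obtain ⟨q, hq⟩ := exists_poly_seq_tendsto hg (fun _ : Unit => ν) (fun _ => h.finite)
    (fun _ => h.ae_mem)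
  have h1 := isL2Limit_borelFC hS hf x ν h p (hp ())
  have h2 := isL2Limit_borelFC hS hg x ν h q (hq ())
  have h3 := isL2Limit_borelFC hS (hf.sub hg) x ν h (fun n => p n - q n) ?_
  · refine tendsto_nhds_unique h3 ?_
    simpa using h1.sub h2
  · refine squeeze_zero (fun n => integral_nonneg fun t => sq_nonneg _) (fun n => ?_)
      (by simpa using ((hp ()).const_mul 2).add ((hq ()).const_mul 2))
    have := integral_sub_sq_le (ν := ν) (N := ‖S‖) (f := fun _ => 0)
      (g := fun t => g t - (q n).eval t) (h := fun t => f t - (p n).eval t) (.const 0)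
      (hg.sub (.eval _)) (hf.sub (.eval _)) h.ae_mem
    simp only [zero_sub, neg_sq] at this
    rw [add_comm]
    refine le_trans (le_of_eq (integral_congr_ae (Eventually.of_forall fun t => ?_))) this
    simp only [eval_sub]
    ring

/-- If `p n → f` in `L²(ν)` and `g` is bounded, then `p n g → f g` in `L²(ν)`. -/
theorem tendsto_integral_mul_sub_sq {ν : Measure ℝ} [IsFiniteMeasure ν] {N : ℝ}
    (hν : ∀ᵐ t ∂ν, t ∈ Set.Icc 0 N) (hf : IsBddBorelOn N f) (hg : IsBddBorelOn N g)
    {p : ℕ → ℝ[X]} (hp : Tendsto (fun n => ∫ t, (f t - (p n).eval t) ^ 2 ∂ν) atTop (𝓝 0)) :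
    Tendsto (fun n => ∫ t, (g t * (f t - (p n).eval t)) ^ 2 ∂ν) atTop (𝓝 0) := by
  obtain ⟨C, -, hC⟩ := hg.exists_bound
  refine squeeze_zero (fun n => integral_nonneg fun t => sq_nonneg _) (fun n => ?_)
    (by simpa using hp.const_mul (C ^ 2))
  rw [← integral_const_mul]
  refine integral_mono_ae ((hg.mul (hf.sub (.eval _))).sq.integrable hν)
    (((hf.sub (.eval _)).sq.integrable hν).const_mul _) ?_
  filter_upwards [hν] with t ht
  rw [mul_pow]
  have h1 : g t ^ 2 ≤ C ^ 2 := by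
    rw [← sq_abs]; exact pow_le_pow_left₀ (abs_nonneg _) (hC t ht) 2
  exact mul_le_mul_of_nonneg_right h1 (sq_nonneg _)

theorem borelFC_mul_eval (hS : S.IsPositive) (hf : IsBddBorelOn ‖S‖ f) (q : ℝ[X]) :
    borelFC S (fun t => f t * q.eval t) = borelFC S f * polyOp S q := by
  ext x
  obtain ⟨ν, h⟩ := exists_isSpectralMeasure hS x
  obtain ⟨ν', h'⟩ := exists_isSpectralMeasure hS (polyOp S q x)
  have := h.finite
  obtain ⟨p, hp⟩ := exists_poly_seq_tendsto hf ![ν, ν']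
      (by intro i; fin_cases i; exacts [h.finite, h'.finite])
      (by intro i; fin_cases i; exacts [h.ae_mem, h'.ae_mem])
  have h1 := isL2Limit_borelFC hS hf _ ν' h' p (hp 1)
  have h2 := isL2Limit_borelFC hS (hf.mul (.eval q)) x ν h (fun n => p n * q) ?_
  · simp only [map_mul, mul_apply_eq_comp] at h2
    exact tendsto_nhds_unique h2 h1
  · refine (tendsto_integral_mul_sub_sq h.ae_mem hf (.eval q) (hp 0)).congr fun n => ?_
    refine integral_congr_ae (Eventually.of_forall fun t => ?_)
    simp only [eval_mul]
    ring

theorem borelFC_mul (hS : S.IsPositive) (hf : IsBddBorelOn ‖S‖ f) (hg : IsBddBorelOn ‖S‖ g) :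
    borelFC S (fun t => f t * g t) = borelFC S f * borelFC S g := by
  ext x
  obtain ⟨ν, h⟩ := exists_isSpectralMeasure hS x
  have := h.finite
  obtain ⟨q, hq⟩ := exists_poly_seq_tendsto hg (fun _ : Unit => ν) (fun _ => h.finite)
    (fun _ => h.ae_mem)
  have h1 := ((borelFC S f).continuous.tendsto _).comp
    (isL2Limit_borelFC hS hg _ ν h q (hq ()))
  have h2 : Tendsto (fun n => borelFC S f (polyOp S (q n) x)) atTop
      (𝓝 (borelFC S (fun t => f t * g t) x)) := by
    rw [tendsto_iff_norm_sub_tendsto_zero]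
    have h3 := ((tendsto_integral_mul_sub_sq h.ae_mem hg hf (hq ())).const_mul 2).sqrt
    rw [mul_zero, Real.sqrt_zero] at h3
    refine squeeze_zero (fun _ => norm_nonneg _) (fun n => Real.le_sqrt_of_sq_le ?_) h3
    have hd := hf.mul (hg.sub (.eval (q n)))
    have h4 := (isL2Limit_borelFC hS hd).norm_sq_le hS hd h
    have h5 : borelFC S (fun t => f t * (g t - (q n).eval t)) x =
        borelFC S (fun t => f t * g t) x - borelFC S f (polyOp S (q n) x) := by
      simp only [mul_sub]
      rw [borelFC_sub hS (hf.mul hg) (hf.mul (.eval _)), borelFC_mul_eval hS hf]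
      rfl
    rwa [h5, norm_sub_rev] at h4
  exact tendsto_nhds_unique h2 h1

theorem norm_borelFC_sq (hS : S.IsPositive) (hf : IsBddBorelOn ‖S‖ f)
    (h : IsSpectralMeasure S x ν) : ‖borelFC S f x‖ ^ 2 = ∫ t, f t ^ 2 ∂ν := by
  rw [← inner_self_eq_norm_sq (𝕜 := 𝕜), inner_borelFC hS hf, ← mul_apply_eq_comp,
    ← borelFC_mul hS hf hf, re_inner_borelFC hS (hf.mul hf) h]
  simp only [pow_two]

theorem norm_borelFC_apply_le (hS : S.IsPositive) (hf : IsBddBorelOn ‖S‖ f) {C : ℝ} (hC : 0 ≤ C)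
    (h : ∀ t ∈ Set.Icc 0 ‖S‖, |f t| ≤ C) (x : H) : ‖borelFC S f x‖ ≤ C * ‖x‖ := by
  obtain ⟨ν, hν⟩ := exists_isSpectralMeasure hS x
  have := hν.finite
  refine (pow_le_pow_iff_left₀ (norm_nonneg _) (by positivity) two_ne_zero).1 ?_
  rw [norm_borelFC_sq hS hf hν]
  calc ∫ t, f t ^ 2 ∂ν ≤ ∫ _, C ^ 2 ∂ν := by
        refine integral_mono_ae (hf.sq.integrable hν.ae_mem) (integrable_const _) ?_
        filter_upwards [hν.ae_mem] with t ht
        rw [← sq_abs]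
        exact pow_le_pow_left₀ (abs_nonneg _) (h t ht) 2
    _ = (C * ‖x‖) ^ 2 := by
        rw [integral_const, hν.measureReal_univ, smul_eq_mul]
        ring

/-- Intertwining operators intertwine the functional calculi. -/
theorem comp_borelFC_of_comp_eq {H' : Type*} [NormedAddCommGroup H'] [InnerProductSpace 𝕜 H']
    [CompleteSpace H'] {S' : H' →L[𝕜] H'} (hS : S.IsPositive) (hS' : S'.IsPositive)
    {A : H →L[𝕜] H'} (hA : ∀ x, A (S x) = S' (A x)) (hf : IsBddBorelOn (max ‖S‖ ‖S'‖) f) (x : H) :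
    A (borelFC S f x) = borelFC S' f (A x) := by
  have hpoly : ∀ (p : ℝ[X]) x, A (polyOp S p x) = polyOp S' p (A x) := by
    intro p x
    induction p using Polynomial.induction_on' with
    | add p q hp hq => simp [hp, hq]
    | monomial n c =>
      have key : ∀ x, A ((S ^ n) x) = (S' ^ n) (A x) := by
        induction n with
        | zero => simp
        | succ n ih =>
          intro x
          rw [pow_succ, mul_apply_eq_comp, ih, hA, ← mul_apply_eq_comp, ← pow_succ]
      rw [polyOp_monomial_apply, polyOp_monomial_apply, map_smul, key]
  obtain ⟨ν, h⟩ := exists_isSpectralMeasure hS x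
  obtain ⟨ν', h'⟩ := exists_isSpectralMeasure hS' (A x)
  obtain ⟨p, hp⟩ := exists_poly_seq_tendsto hf ![ν, ν']
      (by intro i; fin_cases i; exacts [h.finite, h'.finite])
      (by
        intro i
        fin_cases i
        · exact h.ae_mem.mono fun t ht => ⟨ht.1, ht.2.trans (le_max_left _ _)⟩
        · exact h'.ae_mem.mono fun t ht => ⟨ht.1, ht.2.trans (le_max_right _ _)⟩)
  have h1 := (A.continuous.tendsto _).comp
    (isL2Limit_borelFC hS (hf.mono (le_max_left _ _)) x ν h p (hp 0))
  have h2 := isL2Limit_borelFC hS' (hf.mono (le_max_right _ _)) _ ν' h' p (hp 1)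
  refine tendsto_nhds_unique h1 (h2.congr fun n => (hpoly _ _).symm)

end BorelCalculus

/-! ### Comparison of integrals of quasi-concave functions -/

section QuasiConcave

open MeasureTheory Filter Topology

/-- A quasi-concave function on `[0, ∞)` in the sense of interpolation theory: `κ` is
non-decreasing, `κ(t) / t` is non-increasing, and `κ` vanishes at `0` and tends to `0` there. -/
structure IsQuasiConcave (κ : ℝ → ℝ) : Prop where
  zero : κ 0 = 0
  mono : MonotoneOn κ (Set.Ici 0)
  quasi : ∀ s t, 0 < s → s ≤ t → κ t * s ≤ κ s * t
  small : ∀ ε, 0 < ε → ∃ h, 0 < h ∧ κ h ≤ ε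

/-- The infimum of the affine functions `u ↦ κ(s) (1 + u / s)`, a concave majorant of a
quasi-concave `κ` with `κ ≤ k ≤ 2 κ`. -/
def concaveMajorant (κ : ℝ → ℝ) (u : ℝ) : ℝ := ⨅ s : Set.Ioi (0 : ℝ), κ s * (1 + u / s)

variable {κ : ℝ → ℝ}

theorem IsQuasiConcave.nonneg (hκ : IsQuasiConcave κ) {s : ℝ} (hs : 0 ≤ s) : 0 ≤ κ s := by
  rw [← hκ.zero]
  exact hκ.mono Set.self_mem_Ici hs hs

theorem IsQuasiConcave.le_affine (hκ : IsQuasiConcave κ) {s u : ℝ} (hs : 0 < s) (hu : 0 ≤ u) :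
    κ u ≤ κ s * (1 + u / s) := by
  have h0 := hκ.nonneg hs.le
  rcases le_total u s with h | h
  · have h1 := hκ.mono hu hs.le h
    have : 0 ≤ κ s * (u / s) := by positivity
    linarith
  · have h1 := hκ.quasi s u hs h
    have h2 : κ u ≤ κ s * u / s := (le_div_iff₀ hs).2 h1
    rw [mul_div_assoc] at h2
    linarith

theorem IsQuasiConcave.bddBelow (hκ : IsQuasiConcave κ) {u : ℝ} (hu : 0 ≤ u) :
    BddBelow (Set.range fun s : Set.Ioi (0 : ℝ) => κ s * (1 + u / s)) :=
  ⟨κ u, by rintro _ ⟨s, rfl⟩; exact hκ.le_affine s.2 hu⟩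

theorem IsQuasiConcave.majorant_le_affine (hκ : IsQuasiConcave κ) {s u : ℝ} (hs : 0 < s)
    (hu : 0 ≤ u) : concaveMajorant κ u ≤ κ s * (1 + u / s) :=
  ciInf_le (hκ.bddBelow hu) (⟨s, hs⟩ : Set.Ioi (0 : ℝ))

theorem IsQuasiConcave.le_majorant (hκ : IsQuasiConcave κ) {u : ℝ} (hu : 0 ≤ u) :
    κ u ≤ concaveMajorant κ u :=
  le_ciInf fun s => hκ.le_affine s.2 hu

theorem IsQuasiConcave.majorant_zero (hκ : IsQuasiConcave κ) : concaveMajorant κ 0 = 0 := by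
  refine le_antisymm (le_of_forall_pos_le_add fun ε hε => ?_) (hκ.zero.symm.le.trans (hκ.le_majorant le_rfl))
  obtain ⟨h, hh, hs⟩ := hκ.small ε hε
  have := hκ.majorant_le_affine hh le_rfl
  simp only [zero_div, add_zero, mul_one] at this
  linarith

theorem IsQuasiConcave.majorant_le (hκ : IsQuasiConcave κ) {u : ℝ} (hu : 0 ≤ u) :
    concaveMajorant κ u ≤ 2 * κ u := by
  rcases hu.eq_or_lt with rfl | hu'
  · rw [hκ.majorant_zero, hκ.zero, mul_zero]
  · have := hκ.majorant_le_affine hu' hu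
    rw [div_self hu'.ne'] at this
    linarith

theorem IsQuasiConcave.majorant_mono (hκ : IsQuasiConcave κ) {u v : ℝ} (hu : 0 ≤ u) (h : u ≤ v) :
    concaveMajorant κ u ≤ concaveMajorant κ v := by
  refine le_ciInf fun s => (hκ.majorant_le_affine s.2 hu).trans ?_
  have hs : (0 : ℝ) < s := s.2
  have := hκ.nonneg hs.le
  gcongr

theorem IsQuasiConcave.majorant_midpoint (hκ : IsQuasiConcave κ) {u h : ℝ} (hu : 0 ≤ u)
    (hh : 0 ≤ h) :
    concaveMajorant κ u + concaveMajorant κ (u + h + h) ≤ 2 * concaveMajorant κ (u + h) := by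
  have : (concaveMajorant κ u + concaveMajorant κ (u + h + h)) / 2 ≤ concaveMajorant κ (u + h) := by
    refine le_ciInf fun s => ?_
    have h1 := hκ.majorant_le_affine s.2 hu
    have h2 := hκ.majorant_le_affine (u := u + h + h) s.2 (by positivity)
    rw [div_le_iff₀ two_pos]
    calc _ ≤ _ := add_le_add h1 h2
      _ = _ := by ring
  linarith

/-- The piecewise linear interpolation of `k` (with `k 0 = 0`) at `0, h, …, n h`, constant beyond
`n h`, written as a combination of truncations `min u s`. -/
def gridInterp (k : ℝ → ℝ) (h : ℝ) (n : ℕ) (u : ℝ) : ℝ :=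
  ∑ i ∈ Finset.range n, (k ((i + 1 : ℕ) * h) - k (i * h)) / h *
    (min ((i + 1 : ℕ) * h) u - min (i * h) u)

theorem IsQuasiConcave.slope_antitone (hκ : IsQuasiConcave κ) {h : ℝ} (hh : 0 < h) :
    Antitone fun i : ℕ =>
      (concaveMajorant κ ((i + 1 : ℕ) * h) - concaveMajorant κ (i * h)) / h := by
  refine antitone_nat_of_succ_le fun i => ?_
  have := hκ.majorant_midpoint (u := i * h) (h := h) (by positivity) hh.le
  have e1 : ((i + 1 : ℕ) : ℝ) * h = i * h + h := by push_cast; ring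
  have e2 : ((i + 1 + 1 : ℕ) : ℝ) * h = i * h + h + h := by push_cast; ring
  rw [e1, e2]
  gcongr ?_ / h
  linarith

theorem IsQuasiConcave.abs_gridInterp_sub_le (hκ : IsQuasiConcave κ) {h : ℝ} (hh : 0 < h) (n : ℕ) :
    (∀ u, n * h ≤ u → gridInterp (concaveMajorant κ) h n u = concaveMajorant κ (n * h)) ∧
    ∀ u, 0 ≤ u → u ≤ n * h →
      |gridInterp (concaveMajorant κ) h n u - concaveMajorant κ u| ≤ concaveMajorant κ h := by
  set k := concaveMajorant κ with hk
  have hkh : 0 ≤ k h := (hκ.nonneg hh.le).trans (hκ.le_majorant hh.le)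
  induction n with
  | zero =>
    refine ⟨fun u _ => by simp [gridInterp, hκ.majorant_zero, hk], fun u hu hu' => ?_⟩
    have : u = 0 := le_antisymm (by simpa using hu') hu
    simpa [this, gridInterp, hκ.majorant_zero, hk] using hkh
  | succ n ih =>
    have e1 : ((n + 1 : ℕ) : ℝ) * h = n * h + h := by push_cast; ring
    have hstep : ∀ u, gridInterp k h (n + 1) u = gridInterp k h n u +
        (k ((n + 1 : ℕ) * h) - k (n * h)) / h * (min ((n + 1 : ℕ) * h) u - min (n * h) u) :=
      fun u => Finset.sum_range_succ _ _
    have hnh : 0 ≤ (n : ℝ) * h := by positivity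
    refine ⟨fun u hu => ?_, fun u hu hu' => ?_⟩
    · have h1 : n * h ≤ u := by linarith
      rw [hstep, ih.1 u h1, min_eq_left hu, min_eq_left h1, e1]
      field_simp
      ring
    · rcases le_total u (n * h) with h1 | h1
      · rw [hstep, min_eq_right hu', min_eq_right h1, sub_self, mul_zero, add_zero]
        exact ih.2 u hu h1
      · rw [hstep, ih.1 u h1, min_eq_right hu', min_eq_left h1]
        have m1 : k (n * h) ≤ k u := hκ.majorant_mono hnh h1
        have m2 : k u ≤ k ((n + 1 : ℕ) * h) := hκ.majorant_mono hu hu'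
        have m3 : k ((n + 1 : ℕ) * h) - k (n * h) ≤ k h := by
          have := hκ.slope_antitone hh (Nat.zero_le n)
          simp only [Nat.cast_zero, zero_mul, zero_add, Nat.cast_one, one_mul, hκ.majorant_zero,
            sub_zero] at this
          exact (div_le_div_iff_of_pos_right hh).1 this
        have m4 : (k ((n + 1 : ℕ) * h) - k (n * h)) / h * (u - n * h) ≤
            k ((n + 1 : ℕ) * h) - k (n * h) := by
          rw [div_mul_eq_mul_div, div_le_iff₀ hh]
          have : u - n * h ≤ h := by linarith
          exact mul_le_mul_of_nonneg_left this (by linarith)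
        have m5 : 0 ≤ (k ((n + 1 : ℕ) * h) - k (n * h)) / h * (u - n * h) :=
          mul_nonneg (div_nonneg (by linarith) hh.le) (by linarith)
        rw [abs_le]
        constructor <;> linarith

/-- Abel summation with non-increasing weights. -/
theorem sum_mul_sub_nonneg {a D : ℕ → ℝ} (ha : Antitone a) (ha0 : ∀ i, 0 ≤ a i)
    (hD : ∀ i, 0 ≤ D i) (hD0 : D 0 = 0) (n : ℕ) :
    0 ≤ ∑ i ∈ Finset.range n, a i * (D (i + 1) - D i) := by
  suffices h : a n * D n ≤ ∑ i ∈ Finset.range n, a i * (D (i + 1) - D i) from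
    (mul_nonneg (ha0 n) (hD n)).trans h
  induction n with
  | zero => simp [hD0]
  | succ n ih =>
    rw [Finset.sum_range_succ]
    have := mul_le_mul_of_nonneg_right (ha n.le_succ) (hD (n + 1))
    simp only [Nat.succ_eq_add_one] at this
    linarith

/-- If the truncated integrals `∫ min(s, P) dν₁` are dominated by `∫ min(s, R) dν₂`, then so are,
up to a factor `2`, the integrals of every quasi-concave function: its concave majorant is a
positive superposition of truncations. -/
theorem IsQuasiConcave.integral_le (hκ : IsQuasiConcave κ) {ν₁ ν₂ : Measure ℝ}
    [IsFiniteMeasure ν₁] [IsFiniteMeasure ν₂] {P R : ℝ → ℝ} {B K : ℝ} (hK : 0 ≤ K)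
    (hP : Integrable P ν₁) (hR : Integrable R ν₂)
    (hP0 : ∀ᵐ t ∂ν₁, 0 ≤ P t ∧ P t ≤ B) (hR0 : ∀ᵐ t ∂ν₂, 0 ≤ R t ∧ R t ≤ B)
    (hκP : Integrable (fun t => κ (P t)) ν₁) (hκR : Integrable (fun t => κ (R t)) ν₂)
    (h : ∀ s, 0 < s → ∫ t, min s (P t) ∂ν₁ ≤ K * ∫ t, min s (R t) ∂ν₂) :
    ∫ t, κ (P t) ∂ν₁ ≤ 2 * K * ∫ t, κ (R t) ∂ν₂ := by
  set k := concaveMajorant κ with hk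
  set m := ν₁.real Set.univ + K * ν₂.real Set.univ with hm
  have hm0 : 0 ≤ m := by positivity
  have key : ∀ h, 0 < h → ∫ t, κ (P t) ∂ν₁ ≤ 2 * K * ∫ t, κ (R t) ∂ν₂ + k h * m := by
    intro δ hδ
    obtain ⟨n, hn⟩ := exists_nat_ge (B / δ)
    rw [div_le_iff₀ hδ] at hn
    have hint : ∀ {ν : Measure ℝ} [IsFiniteMeasure ν] {Q : ℝ → ℝ}, Integrable Q ν → ∀ s,
        Integrable (fun t => min s (Q t)) ν := fun hQ s => (integrable_const s).inf hQ
    have hgrid : ∀ {ν : Measure ℝ} [IsFiniteMeasure ν] {Q : ℝ → ℝ}, Integrable Q ν →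
        Integrable (fun t => gridInterp k δ n (Q t)) ν ∧
        ∫ t, gridInterp k δ n (Q t) ∂ν = ∑ i ∈ Finset.range n,
          (k ((i + 1 : ℕ) * δ) - k (i * δ)) / δ *
            (∫ t, min ((i + 1 : ℕ) * δ) (Q t) ∂ν - ∫ t, min (i * δ) (Q t) ∂ν) := by
      intro ν _ Q hQ
      have hi : ∀ i ∈ Finset.range n, Integrable (fun t =>
          (k ((i + 1 : ℕ) * δ) - k (i * δ)) / δ *
            (min ((i + 1 : ℕ) * δ) (Q t) - min (i * δ) (Q t))) ν :=
        fun i _ => ((hint hQ _).sub (hint hQ _)).const_mul _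
      refine ⟨integrable_finsetSum _ hi, ?_⟩
      simp only [gridInterp]
      rw [integral_finsetSum _ hi]
      refine Finset.sum_congr rfl fun i _ => ?_
      rw [integral_const_mul, integral_sub (hint hQ _) (hint hQ _)]
    obtain ⟨gP, eP⟩ := hgrid hP
    obtain ⟨gR, eR⟩ := hgrid hR
    have hapx := (hκ.abs_gridInterp_sub_le hδ n).2
    have h1 : ∫ t, κ (P t) ∂ν₁ ≤ ∫ t, gridInterp k δ n (P t) ∂ν₁ + k δ * ν₁.real Set.univ := by
      calc ∫ t, κ (P t) ∂ν₁ ≤ ∫ t, (gridInterp k δ n (P t) + k δ) ∂ν₁ := by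
            refine integral_mono_ae hκP (gP.add (integrable_const _)) ?_
            filter_upwards [hP0] with t ht
            have := (abs_le.1 (hapx (P t) ht.1 (ht.2.trans hn))).1
            have := hκ.le_majorant ht.1
            linarith
        _ = _ := by
            rw [integral_add gP (integrable_const _), integral_const, smul_eq_mul, mul_comm (k δ)]
    have h2 : ∫ t, gridInterp k δ n (R t) ∂ν₂ ≤
        2 * ∫ t, κ (R t) ∂ν₂ + k δ * ν₂.real Set.univ := by
      calc ∫ t, gridInterp k δ n (R t) ∂ν₂ ≤ ∫ t, (2 * κ (R t) + k δ) ∂ν₂ := by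
            refine integral_mono_ae gR ((hκR.const_mul 2).add (integrable_const _)) ?_
            filter_upwards [hR0] with t ht
            have := (abs_le.1 (hapx (R t) ht.1 (ht.2.trans hn))).2
            have := hκ.majorant_le ht.1
            linarith
        _ = _ := by
            rw [integral_add (hκR.const_mul 2) (integrable_const _), integral_const, smul_eq_mul,
              mul_comm (k δ), integral_const_mul]
    have hzero : K * ∫ t, min (((0 : ℕ) : ℝ) * δ) (R t) ∂ν₂ -
        ∫ t, min (((0 : ℕ) : ℝ) * δ) (P t) ∂ν₁ = 0 := by
      rw [integral_eq_zero_of_ae (hR0.mono fun t ht => by simp [ht.1]),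
        integral_eq_zero_of_ae (hP0.mono fun t ht => by simp [ht.1]), mul_zero, sub_zero]
    have h3 : ∫ t, gridInterp k δ n (P t) ∂ν₁ ≤ K * ∫ t, gridInterp k δ n (R t) ∂ν₂ := by
      have := sum_mul_sub_nonneg (hκ.slope_antitone hδ) (fun i => ?_)
        (D := fun i : ℕ => K * ∫ t, min (i * δ) (R t) ∂ν₂ - ∫ t, min (i * δ) (P t) ∂ν₁) ?_ hzero n
      · rw [eP, eR, ← sub_nonneg, Finset.mul_sum, ← Finset.sum_sub_distrib]
        refine this.trans (le_of_eq (Finset.sum_congr rfl fun i _ => ?_))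
        ring
      · refine div_nonneg (sub_nonneg.2 (hκ.majorant_mono (by positivity) ?_)) hδ.le
        push_cast
        nlinarith
      · intro i
        rcases i.eq_zero_or_pos with rfl | hi
        · exact hzero.ge
        · exact sub_nonneg.2 (h _ (by positivity))
    have h4 := mul_le_mul_of_nonneg_left h2 hK
    rw [hm]
    linarith
  refine le_of_forall_pos_le_add fun ε hε => ?_
  obtain ⟨δ, hδ, hs⟩ := hκ.small (ε / (2 * (m + 1))) (by positivity)
  have h1 := key δ hδ
  have h2 : k δ ≤ ε / (m + 1) := by
    refine (hκ.majorant_le hδ.le).trans ?_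
    calc 2 * κ δ ≤ 2 * (ε / (2 * (m + 1))) := by linarith
      _ = ε / (m + 1) := by field_simp
  have h3 : k δ * m ≤ ε := by
    calc k δ * m ≤ ε / (m + 1) * m := mul_le_mul_of_nonneg_right h2 hm0
      _ ≤ ε := by
        rw [div_mul_eq_mul_div, div_le_iff₀ (by positivity)]
        nlinarith
  linarith

end QuasiConcave

/-! ### Interpolation between two positive operators -/

section Interpolation

open MeasureTheory Filter Topology

variable {𝕜 H : Type*} [RCLike 𝕜] [NormedAddCommGroup H] [InnerProductSpace 𝕜 H] [CompleteSpace H]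
  {G S : H →L[𝕜] H} {x : H} {f g p r : ℝ → ℝ} {N s c : ℝ}

theorem IsBddBorelOn.ite_le (hf : IsBddBorelOn N f) (s : ℝ) :
    IsBddBorelOn N (fun t => if f t ≤ s then 1 else 0) := by
  obtain ⟨f', hm, -, he⟩ := hf
  refine IsBddBorelOn.congr (f := fun t => if f' t ≤ s then 1 else 0)
    (.of_measurable (Measurable.ite (hm measurableSet_Iic) measurable_const measurable_const) 1
      fun t _ => ?_) fun t ht => by simp only [he ht]
  split_ifs <;> simp

theorem norm_borelFC_apply_mono (hS : S.IsPositive) (hf : IsBddBorelOn ‖S‖ f)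
    (hg : IsBddBorelOn ‖S‖ g) (h : ∀ t ∈ Set.Icc 0 ‖S‖, |f t| ≤ |g t|) (x : H) :
    ‖borelFC S f x‖ ≤ ‖borelFC S g x‖ := by
  obtain ⟨ν, hν⟩ := exists_isSpectralMeasure hS x
  have := hν.finite
  refine (pow_le_pow_iff_left₀ (norm_nonneg _) (norm_nonneg _) two_ne_zero).1 ?_
  rw [norm_borelFC_sq hS hf hν, norm_borelFC_sq hS hg hν]
  refine integral_mono_ae (hf.sq.integrable hν.ae_mem) (hg.sq.integrable hν.ae_mem) ?_
  filter_upwards [hν.ae_mem] with t ht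
  exact sq_le_sq.2 (h t ht)

/-- If `c ‖p(G) w‖ ≤ ‖r(S) w‖` for all `w`, the truncated integrals of `p²` and `r²` against the
spectral measures of `G` and `S` at the same vector compare.  Up to constants they are the
`K`-functionals of the pairs `(‖w‖², ‖p(G) w‖²)` and `(‖w‖², ‖r(S) w‖²)`. -/
theorem integral_min_sq_le (hG : G.IsPositive) (hS : S.IsPositive) (hp : IsBddBorelOn ‖G‖ p)
    (hr : IsBddBorelOn ‖S‖ r) (hp0 : ∀ t ∈ Set.Icc 0 ‖G‖, 0 ≤ p t) (hc : 0 < c) (hc1 : c ≤ 1)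
    (h : ∀ w, c * ‖borelFC G p w‖ ≤ ‖borelFC S r w‖) {ν₁ ν₂ : Measure ℝ}
    (h₁ : IsSpectralMeasure G x ν₁) (h₂ : IsSpectralMeasure S x ν₂) (hs : 0 < s) :
    ∫ t, min s (p t ^ 2) ∂ν₁ ≤ 2 / c ^ 2 * ∫ t, min s (r t ^ 2) ∂ν₂ := by
  have := h₁.finite
  have := h₂.finite
  set g : ℝ → ℝ := fun t => min (Real.sqrt s) (p t) with hg
  have hgB : IsBddBorelOn ‖G‖ g := (IsBddBorelOn.const _).min hp
  -- the spectral cut-off of `S` at the level where `r² = s` is a near-optimal splitting of `x`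
  set e : ℝ → ℝ := fun t => if r t ^ 2 ≤ s then 1 else 0 with he
  have heB : IsBddBorelOn ‖S‖ e := hr.sq.ite_le s
  have heB' : IsBddBorelOn ‖S‖ (fun t => 1 - e t) := (IsBddBorelOn.const 1).sub heB
  set x₁ := borelFC S (fun t => 1 - e t) x with hx₁
  set x₂ := borelFC S e x with hx₂
  have hx : x = x₁ + x₂ := by
    rw [hx₁, hx₂, borelFC_sub hS (.const 1) heB, borelFC_one hS]
    simp
  have n1 : ‖x₁‖ ^ 2 = ∫ t, (1 - e t) ^ 2 ∂ν₂ := norm_borelFC_sq hS heB' h₂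
  have n2 : ‖borelFC S r x₂‖ ^ 2 = ∫ t, (r t * e t) ^ 2 ∂ν₂ := by
    rw [hx₂, ← mul_apply_eq_comp, ← borelFC_mul hS hr heB, norm_borelFC_sq hS (hr.mul heB) h₂]
  have b1 : ‖borelFC G g x₁‖ ≤ Real.sqrt s * ‖x₁‖ := by
    refine norm_borelFC_apply_le hG hgB (Real.sqrt_nonneg s) (fun t ht => ?_) _
    rw [abs_of_nonneg (le_min (Real.sqrt_nonneg s) (hp0 t ht))]
    exact min_le_left _ _
  have b2 : ‖borelFC G g x₂‖ ≤ ‖borelFC G p x₂‖ := by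
    refine norm_borelFC_apply_mono hG hgB hp (fun t ht => ?_) _
    rw [abs_of_nonneg (le_min (Real.sqrt_nonneg s) (hp0 t ht)), abs_of_nonneg (hp0 t ht)]
    exact min_le_right _ _
  have b3 : ‖borelFC G p x₂‖ ≤ ‖borelFC S r x₂‖ / c := by
    rw [le_div_iff₀ hc, mul_comm]
    exact h x₂
  have b4 : ‖borelFC G g x‖ ≤ Real.sqrt s * ‖x₁‖ + ‖borelFC S r x₂‖ / c := by
    calc ‖borelFC G g x‖ = ‖borelFC G g x₁ + borelFC G g x₂‖ := by rw [← map_add, ← hx]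
      _ ≤ _ := (norm_add_le _ _).trans (add_le_add b1 (b2.trans b3))
  have b5 : ‖borelFC G g x‖ ^ 2 ≤ 2 / c ^ 2 * (s * ‖x₁‖ ^ 2 + ‖borelFC S r x₂‖ ^ 2) := by
    have h1 := pow_le_pow_left₀ (norm_nonneg _) b4 2
    have h2 := add_sq_le (a := Real.sqrt s * ‖x₁‖) (b := ‖borelFC S r x₂‖ / c)
    rw [mul_pow, Real.sq_sqrt hs.le, div_pow] at h2
    have h3 : s * ‖x₁‖ ^ 2 ≤ s * ‖x₁‖ ^ 2 / c ^ 2 :=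
      le_div_self (by positivity) (by positivity) (pow_le_one₀ hc.le hc1)
    calc _ ≤ _ := h1.trans h2
      _ ≤ 2 * (s * ‖x₁‖ ^ 2 / c ^ 2 + ‖borelFC S r x₂‖ ^ 2 / c ^ 2) := by gcongr
      _ = _ := by ring
  have e1 : ∫ t, min s (p t ^ 2) ∂ν₁ = ‖borelFC G g x‖ ^ 2 := by
    rw [norm_borelFC_sq hG hgB h₁]
    refine integral_congr_ae ?_
    filter_upwards [h₁.ae_mem] with t ht
    simp only [hg]
    rcases le_total (Real.sqrt s) (p t) with h | h
    · rw [min_eq_left h, Real.sq_sqrt hs.le, min_eq_left ((Real.sqrt_le_left (hp0 t ht)).1 h)]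
    · rw [min_eq_right h, min_eq_right ((Real.le_sqrt (hp0 t ht) hs.le).1 h)]
  have e2 : ∫ t, min s (r t ^ 2) ∂ν₂ = s * ‖x₁‖ ^ 2 + ‖borelFC S r x₂‖ ^ 2 := by
    rw [n1, n2, ← integral_const_mul, ← integral_add ((heB'.sq.integrable h₂.ae_mem).const_mul s)
      ((hr.mul heB).sq.integrable h₂.ae_mem)]
    refine integral_congr_ae (Eventually.of_forall fun t => ?_)
    simp only [he]
    split_ifs with h
    · simp [min_eq_right h]
    · simp [min_eq_left (not_le.1 h).le]
  rw [e1, e2]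
  exact b5

end Interpolation

/-! ### Index functions and the function `f₀` -/

section IndexFunctions

open Filter Topology

variable {φ ψ : ℝ → ℝ} {μ : ℝ}

theorem IsIndexFunction.nonneg (hφ : IsIndexFunction φ) {t : ℝ} (ht : 0 ≤ t) : 0 ≤ φ t := by
  rcases ht.eq_or_lt with rfl | h
  · exact hφ.zero.ge
  · exact (hφ.pos t h).le

theorem IsIndexFunction.isBddBorelOn (hφ : IsIndexFunction φ) (N : ℝ) : IsBddBorelOn N φ :=
  .of_monotoneOn hφ.mono

theorem Theta_nonneg (hψ : IsIndexFunction ψ) {t : ℝ} (ht : 0 ≤ t) : 0 ≤ Theta ψ t :=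
  mul_nonneg (Real.sqrt_nonneg _) (hψ.nonneg ht)

theorem Theta_strictMonoOn (hψ : IsIndexFunction ψ) : StrictMonoOn (Theta ψ) (Set.Ici 0) := by
  intro s hs t ht h
  have ht' : 0 < t := lt_of_le_of_lt hs h
  calc Real.sqrt s * ψ s ≤ Real.sqrt s * ψ t :=
        mul_le_mul_of_nonneg_left (hψ.mono hs ht h.le) (Real.sqrt_nonneg s)
    _ < Real.sqrt t * ψ t := mul_lt_mul_of_pos_right (Real.sqrt_lt_sqrt hs h) (hψ.pos t ht')

theorem Theta_monotoneOn (hψ : IsIndexFunction ψ) : MonotoneOn (Theta ψ) (Set.Ici 0) :=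
  (Theta_strictMonoOn hψ).monotoneOn

theorem exists_Theta_sq_eq (hψ : IsIndexFunction ψ) {u : ℝ} (hu : 0 ≤ u) :
    ∃ l ∈ Set.Ici (0 : ℝ), Theta ψ l ^ 2 = u := by
  have h1 : 0 < ψ 1 := hψ.pos 1 one_pos
  -- `Θ(b)² ≥ b ψ(1)²` for `b ≥ 1`
  set b := 1 + u / ψ 1 ^ 2 with hb
  have hb1 : 1 ≤ b := le_add_of_nonneg_right (by positivity)
  have hb0 : 0 ≤ b := zero_le_one.trans hb1
  have hcont : ContinuousOn (fun l => Theta ψ l ^ 2) (Set.Icc 0 b) :=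
    ((Real.continuous_sqrt.continuousOn.mul hψ.cont).pow 2).mono Set.Icc_subset_Ici_self
  have hub : u ≤ Theta ψ b ^ 2 := by
    rw [Theta, mul_pow, Real.sq_sqrt hb0]
    have h2 : ψ 1 ^ 2 ≤ ψ b ^ 2 :=
      pow_le_pow_left₀ h1.le (hψ.mono (Set.mem_Ici.2 zero_le_one) (Set.mem_Ici.2 hb0) hb1) 2
    calc u = u / ψ 1 ^ 2 * ψ 1 ^ 2 := by field_simp
      _ ≤ b * ψ b ^ 2 := mul_le_mul (by linarith) h2 (by positivity) hb0
  obtain ⟨l, hl, he⟩ := intermediate_value_Icc hb0 hcont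
    (show u ∈ Set.Icc _ _ from ⟨by simpa [Theta] using hu, hub⟩)
  exact ⟨l, hl.1, he⟩

theorem Theta_f0_sq (hψ : IsIndexFunction ψ) {u : ℝ} (hu : 0 ≤ u) :
    Theta ψ (f0 ψ u ^ 2) ^ 2 = u := by
  have h := exists_Theta_sq_eq hψ hu
  have h0 : 0 ≤ Function.invFunOn (fun l => Theta ψ l ^ 2) (Set.Ici 0) u :=
    Function.invFunOn_mem (f := fun l => Theta ψ l ^ 2) h
  rw [f0, Real.sq_sqrt h0]
  exact Function.invFunOn_eq (f := fun l => Theta ψ l ^ 2) h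

theorem f0_sq_le_f0_sq (hψ : IsIndexFunction ψ) {u v : ℝ} (hu : 0 ≤ u) (h : u ≤ v) :
    f0 ψ u ^ 2 ≤ f0 ψ v ^ 2 := by
  by_contra! hlt
  have h1 := Theta_strictMonoOn hψ (Set.mem_Ici.2 (sq_nonneg _)) (Set.mem_Ici.2 (sq_nonneg _)) hlt
  have h2 := pow_lt_pow_left₀ h1 (Theta_nonneg hψ (sq_nonneg _)) two_ne_zero
  rw [Theta_f0_sq hψ hu, Theta_f0_sq hψ (hu.trans h)] at h2
  exact absurd h h2.not_ge

theorem f0_sq_Theta_sq (hψ : IsIndexFunction ψ) {l : ℝ} (hl : 0 ≤ l) :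
    f0 ψ (Theta ψ l ^ 2) ^ 2 = l := by
  have h1 := Theta_f0_sq hψ (sq_nonneg (Theta ψ l))
  rw [pow_left_inj₀ (Theta_nonneg hψ (sq_nonneg _)) (Theta_nonneg hψ hl) two_ne_zero] at h1
  exact (Theta_strictMonoOn hψ).injOn (Set.mem_Ici.2 (sq_nonneg _)) hl h1

theorem Theta_zero : Theta ψ 0 = 0 := by simp [Theta]

theorem f0_zero_sq (hψ : IsIndexFunction ψ) : f0 ψ 0 ^ 2 = 0 := by
  simpa [Theta_zero] using f0_sq_Theta_sq hψ le_rfl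

theorem phi_f0_monotoneOn (hφ : IsIndexFunction φ) (hψ : IsIndexFunction ψ) :
    MonotoneOn (fun t => φ (f0 ψ t ^ 2)) (Set.Ici 0) := fun _ hs _ _ h =>
  hφ.mono (Set.mem_Ici.2 (sq_nonneg _)) (Set.mem_Ici.2 (sq_nonneg _)) (f0_sq_le_f0_sq hψ hs h)

theorem Theta_rpow_monotoneOn (hψ : IsIndexFunction ψ) (hμ : 0 < μ) :
    MonotoneOn (fun t => Theta ψ t ^ μ) (Set.Ici 0) := fun _ hs _ ht h =>
  Real.rpow_le_rpow (Theta_nonneg hψ hs) (Theta_monotoneOn hψ hs ht h) hμ.le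

theorem rpow_half_sq {t : ℝ} (ht : 0 ≤ t) (μ : ℝ) : (t ^ (μ / 2)) ^ 2 = t ^ μ := by
  rw [← Real.rpow_natCast, ← Real.rpow_mul ht]
  congr 1
  push_cast
  ring

theorem sq_rpow_rpow_inv {t : ℝ} (ht : 0 ≤ t) (hμ : 0 < μ) : ((t ^ μ) ^ 2) ^ μ⁻¹ = t ^ 2 := by
  rw [← Real.rpow_natCast, ← Real.rpow_natCast, ← Real.rpow_mul ht, ← Real.rpow_mul ht]
  congr 1
  field_simp

/-- The function `κ` with `κ(Θ^{2μ}) = φ²` is quasi-concave as soon as `φ ≺ Θ^μ`. -/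
theorem isQuasiConcave_of_prec (hφ : IsIndexFunction φ) (hψ : IsIndexFunction ψ) (hμ : 0 < μ)
    (h : Prec φ (fun t => Theta ψ t ^ μ)) :
    IsQuasiConcave fun u => φ (f0 ψ (u ^ μ⁻¹) ^ 2) ^ 2 := by
  have hμ' : 0 < μ⁻¹ := inv_pos.2 hμ
  refine ⟨?_, ?_, ?_, ?_⟩
  · rw [Real.zero_rpow hμ'.ne', f0_zero_sq hψ, hφ.zero]
    simp
  · intro s hs t ht hst
    refine pow_le_pow_left₀ (hφ.nonneg (sq_nonneg _)) ?_ 2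
    exact phi_f0_monotoneOn hφ hψ (Real.rpow_nonneg hs _) (Real.rpow_nonneg ht _)
      (Real.rpow_le_rpow hs hst hμ'.le)
  · intro s t hs hst
    have key : ∀ v, 0 < v → (Theta ψ (f0 ψ (v ^ μ⁻¹) ^ 2) ^ μ) ^ 2 = v ∧
        0 < f0 ψ (v ^ μ⁻¹) ^ 2 := by
      intro v hv
      have h1 := Theta_f0_sq hψ (Real.rpow_nonneg hv.le μ⁻¹)
      have h2 := Theta_nonneg hψ (sq_nonneg (f0 ψ (v ^ μ⁻¹)))
      constructor
      · rw [← Real.rpow_natCast, ← Real.rpow_mul h2, mul_comm, Real.rpow_mul h2, Real.rpow_natCast,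
          h1, ← Real.rpow_mul hv.le, inv_mul_cancel₀ hμ.ne', Real.rpow_one]
      · refine (sq_nonneg _).lt_of_ne' fun h0 => ?_
        rw [h0, Theta_zero] at h1
        have := Real.rpow_pos_of_pos hv μ⁻¹
        simp only [ne_eq, OfNat.ofNat_ne_zero, not_false_eq_true, zero_pow] at h1
        linarith
    obtain ⟨es, ps⟩ := key s hs
    obtain ⟨et, pt⟩ := key t (hs.trans_le hst)
    have hle := f0_sq_le_f0_sq hψ (Real.rpow_nonneg hs.le _) (Real.rpow_le_rpow hs.le hst hμ'.le)
    have h1 := h.mono ps.le pt.le hle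
    simp only at h1 ⊢
    rw [div_le_div_iff₀ (hφ.pos _ ps) (hφ.pos _ pt)] at h1
    have h2 := pow_le_pow_left₀ (mul_nonneg (Real.rpow_nonneg
      (Theta_nonneg hψ ps.le) _) (hφ.nonneg pt.le)) h1 2
    rw [mul_pow, mul_pow, es, et] at h2
    linarith
  · intro ε hε
    have hc : Tendsto (fun t => φ t ^ 2) (𝓝[>] 0) (𝓝 0) := by
      have h1 : Tendsto φ (𝓝[≥] 0) (𝓝 (φ 0)) := hφ.cont 0 Set.self_mem_Ici
      rw [hφ.zero] at h1
      simpa using (h1.mono_left (nhdsWithin_mono 0 Set.Ioi_subset_Ici_self)).pow 2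
    obtain ⟨l, hl, hl0⟩ := ((hc.eventually_le_const hε).and self_mem_nhdsWithin).exists
    have hl0 : 0 < l := hl0
    have hpos : 0 < Theta ψ l := by
      simpa [Theta_zero] using Theta_strictMonoOn hψ Set.self_mem_Ici hl0.le hl0
    refine ⟨(Theta ψ l ^ μ) ^ 2, pow_pos (Real.rpow_pos_of_pos hpos _) 2, ?_⟩
    rwa [sq_rpow_rpow_inv hpos.le hμ, f0_sq_Theta_sq hψ hl0.le]

/-- The lifted link condition transfers to every `φ ≺ Θ^μ`: smoothness `φ` with respect to `G`
is dominated by smoothness `φ ∘ f₀²` with respect to `S`. -/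
theorem norm_borelFC_le_of_prec {𝕜 H : Type*} [RCLike 𝕜] [NormedAddCommGroup H]
    [InnerProductSpace 𝕜 H] [CompleteSpace H] {G S : H →L[𝕜] H} {c : ℝ} (hG : G.IsPositive)
    (hS : S.IsPositive) (hφ : IsIndexFunction φ) (hψ : IsIndexFunction ψ) (hμ : 0 < μ)
    (hprec : Prec φ (fun t => Theta ψ t ^ μ)) (hc : 0 < c) (hc1 : c ≤ 1)
    (h : ∀ w, c * ‖borelFC G (fun t => Theta ψ t ^ μ) w‖ ≤ ‖borelFC S (fun t => t ^ (μ / 2)) w‖)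
    (x : H) : ‖borelFC G φ x‖ ≤ 2 / c * ‖borelFC S (fun t => φ (f0 ψ t ^ 2)) x‖ := by
  obtain ⟨ν₁, h₁⟩ := exists_isSpectralMeasure hG x
  obtain ⟨ν₂, h₂⟩ := exists_isSpectralMeasure hS x
  have := h₁.finite
  have := h₂.finite
  have hp : IsBddBorelOn ‖G‖ (fun t => Theta ψ t ^ μ) :=
    .of_monotoneOn (Theta_rpow_monotoneOn hψ hμ)
  have hr : IsBddBorelOn ‖S‖ (fun t => t ^ (μ / 2)) :=
    .of_monotoneOn fun _ hs _ _ hst => Real.rpow_le_rpow hs hst (by positivity)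
  have hφB := hφ.isBddBorelOn ‖G‖
  have hφf : IsBddBorelOn ‖S‖ (fun t => φ (f0 ψ t ^ 2)) :=
    .of_monotoneOn (phi_f0_monotoneOn hφ hψ)
  have eP : ∀ t ∈ Set.Icc 0 ‖G‖, φ (f0 ψ (((Theta ψ t ^ μ) ^ 2) ^ μ⁻¹) ^ 2) ^ 2 = φ t ^ 2 := by
    intro t ht
    rw [sq_rpow_rpow_inv (Theta_nonneg hψ ht.1) hμ, f0_sq_Theta_sq hψ ht.1]
  have eR : ∀ t ∈ Set.Icc 0 ‖S‖,
      φ (f0 ψ (((t ^ (μ / 2)) ^ 2) ^ μ⁻¹) ^ 2) ^ 2 = φ (f0 ψ t ^ 2) ^ 2 := by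
    intro t ht
    rw [rpow_half_sq ht.1, ← Real.rpow_mul ht.1, mul_inv_cancel₀ hμ.ne', Real.rpow_one]
  obtain ⟨B₁, -, hB₁⟩ := hp.sq.exists_bound
  obtain ⟨B₂, -, hB₂⟩ := hr.sq.exists_bound
  have key := (isQuasiConcave_of_prec hφ hψ hμ hprec).integral_le (ν₁ := ν₁) (ν₂ := ν₂)
    (P := fun t => (Theta ψ t ^ μ) ^ 2) (R := fun t => (t ^ (μ / 2)) ^ 2) (B := max B₁ B₂)
    (K := 2 / c ^ 2) (by positivity) (hp.sq.integrable h₁.ae_mem) (hr.sq.integrable h₂.ae_mem)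
    (h₁.ae_mem.mono fun t ht =>
      ⟨sq_nonneg _, (le_abs_self _).trans ((hB₁ t ht).trans (le_max_left _ _))⟩)
    (h₂.ae_mem.mono fun t ht =>
      ⟨sq_nonneg _, (le_abs_self _).trans ((hB₂ t ht).trans (le_max_right _ _))⟩)
    ((hφB.sq.congr eP).integrable h₁.ae_mem) ((hφf.sq.congr eR).integrable h₂.ae_mem)
    (fun s hs => integral_min_sq_le hG hS hp hr
      (fun t ht => Real.rpow_nonneg (Theta_nonneg hψ ht.1) _) hc hc1 h h₁ h₂ hs)
  refine (pow_le_pow_iff_left₀ (norm_nonneg _) (by positivity) two_ne_zero).1 ?_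
  rw [mul_pow, norm_borelFC_sq hG hφB h₁, norm_borelFC_sq hS hφf h₂]
  calc ∫ t, φ t ^ 2 ∂ν₁ = _ :=
        (MeasureTheory.integral_congr_ae (h₁.ae_mem.mono fun t ht => eP t ht)).symm
    _ ≤ _ := key
    _ = 2 * (2 / c ^ 2) * ∫ t, φ (f0 ψ t ^ 2) ^ 2 ∂ν₂ := by
        rw [MeasureTheory.integral_congr_ae (h₂.ae_mem.mono fun t ht => eR t ht)]
    _ = _ := by ring

end IndexFunctions

/-! ### The error bound -/

section ErrorBound

open MeasureTheory ContinuousLinearMap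

variable {𝕜 X Y Z : Type*} [RCLike 𝕜]
  [NormedAddCommGroup X] [InnerProductSpace 𝕜 X] [CompleteSpace X]
  [NormedAddCommGroup Y] [InnerProductSpace 𝕜 Y] [CompleteSpace Y]
  [NormedAddCommGroup Z] [InnerProductSpace 𝕜 Z] [CompleteSpace Z]

theorem isBddBorelOn_sqrt (N : ℝ) : IsBddBorelOn N Real.sqrt :=
  .of_monotoneOn (Real.sqrt_monotone.monotoneOn _)

theorem norm_borelFC_sqrt (T : X →L[𝕜] Y) (x : X) :
    ‖borelFC ((adjoint T).comp T) Real.sqrt x‖ = ‖T x‖ := by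
  have hS := isPositive_adjoint_comp_self T
  obtain ⟨ν, hν⟩ := exists_isSpectralMeasure hS x
  refine (pow_left_inj₀ (norm_nonneg _) (norm_nonneg _) two_ne_zero).1 ?_
  rw [norm_borelFC_sq hS (isBddBorelOn_sqrt _) hν]
  have h1 : ∫ t, Real.sqrt t ^ 2 ∂ν = ∫ t, t ^ 1 ∂ν := by
    refine integral_congr_ae (hν.ae_mem.mono fun t ht => ?_)
    simp only [Real.sq_sqrt ht.1, pow_one]
  rw [h1, hν.moments, pow_one, comp_apply, adjoint_inner_right, inner_self_eq_norm_sq]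

theorem norm_adjoint_apply_le {L : X →L[𝕜] Y} {C : ℝ} (hC : 0 ≤ C) (h : ∀ x, ‖L x‖ ≤ C * ‖x‖)
    (y : Y) : ‖adjoint L y‖ ≤ C * ‖y‖ := by
  refine ((adjoint L).le_opNorm y).trans (mul_le_mul_of_nonneg_right ?_ (norm_nonneg y))
  rw [LinearIsometryEquiv.norm_map]
  exact L.opNorm_le_bound hC h

/-- On the range of `A` the link condition reads `m ‖Θ(A*A) w‖ ≤ ‖(T*T)^{1/2} w‖`. -/
theorem LinkCondition.le_norm_sqrt {A : X →L[𝕜] Y} {E : Y →L[𝕜] Z} {ψ : ℝ → ℝ} {m M : ℝ}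
    (h : LinkCondition A E ψ m M) (w : X) :
    m * ‖borelFC ((adjoint A).comp A) (Theta ψ) w‖ ≤
      ‖borelFC ((adjoint (preOp A E)).comp (preOp A E)) Real.sqrt w‖ := by
  have hG := isPositive_adjoint_comp_self A
  have hG' := isPositive_self_comp_adjoint A
  have h1 := h.lower (A w)
  have h2 : E.comp (adjoint E) = (adjoint (adjoint E)).comp (adjoint E) := by rw [adjoint_adjoint]
  rw [h2, norm_borelFC_sqrt, ← comp_borelFC_of_comp_eq hG hG' (fun _ => rfl)
    (h.index.isBddBorelOn _), ← norm_borelFC_sqrt A, ← mul_apply_eq_comp,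
    ← borelFC_mul hG (isBddBorelOn_sqrt _) (h.index.isBddBorelOn _)] at h1
  rw [norm_borelFC_sqrt]
  exact h1

theorem IsRegularization.isBddBorelOn {q : ℝ → ℝ → ℝ} {a γ γs α N : ℝ}
    (hq : IsRegularization q a γ γs) (hα : 0 < α) (hαa : α ≤ a) (hN : N ≤ a) :
    IsBddBorelOn N (q α) := by
  refine .of_measurable (hq.meas α hα hαa) (max |q α 0| (γs / α)) fun t ht => ?_
  -- the hypotheses leave the value `q α 0` free
  rcases ht.1.eq_or_lt with rfl | h
  · exact le_max_left _ _
  · exact (hq.bound α hα hαa t h (ht.2.trans hN)).trans (le_max_right _ _)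

/-- The error splits into the residual applied to the exact solution and propagated noise. -/
theorem sub_regSolution_eq {A : X →L[𝕜] Y} {E : Y →L[𝕜] Z} {q : ℝ → ℝ → ℝ} {α δ : ℝ}
    (hq : IsBddBorelOn ‖(adjoint (preOp A E)).comp (preOp A E)‖ (q α)) (f : X) (ζ : Z) :
    f - regSolution A E q α (noisyData A E f δ ζ) =
      borelFC ((adjoint (preOp A E)).comp (preOp A E)) (fun t => 1 - t * q α t) f -
        (δ : 𝕜) • borelFC ((adjoint (preOp A E)).comp (preOp A E)) (q α)
          (adjoint (preOp A E) (adjoint E ζ)) := by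
  set T := preOp A E with hT
  have hS := isPositive_adjoint_comp_self T
  have hid : IsBddBorelOn ‖(adjoint T).comp T‖ (fun t => t) :=
    .of_continuousOn continuous_id.continuousOn
  have h1 : borelFC ((adjoint T).comp T) (fun t => 1 - t * q α t) f =
      f - borelFC ((adjoint T).comp T) (q α) (adjoint T (T f)) := by
    have h2 : (fun t => 1 - t * q α t) = fun t => 1 - q α t * t := by
      funext t
      rw [mul_comm]
    rw [h2, borelFC_sub hS (.const 1) (hq.mul hid), borelFC_one hS, borelFC_mul hS hq hid,
      borelFC_id hS]
    rfl
  have h3 : adjoint E (noisyData A E f δ ζ) = T f + (δ : 𝕜) • adjoint E ζ := by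
    simp [noisyData, hT, preOp]
  rw [h1, regSolution, ← hT, h3, map_add, map_add, map_smul, map_smul]
  abel

theorem norm_borelFC_adjoint_apply_le {T : X →L[𝕜] Y} {q : ℝ → ℝ → ℝ} {a γ γs α : ℝ}
    (ha : ‖(adjoint T).comp T‖ ≤ a) (hq : IsRegularization q a γ γs) (hα : 0 < α) (hαa : α ≤ a)
    (y : Y) :
    ‖borelFC ((adjoint T).comp T) (q α) (adjoint T y)‖ ≤
      Real.sqrt (|γs| * (1 + |γ|)) / Real.sqrt α * ‖y‖ := by
  have hS := isPositive_adjoint_comp_self T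
  have hqB := hq.isBddBorelOn hα hαa ha
  have hb : ∀ x, ‖(T.comp (borelFC ((adjoint T).comp T) (q α))) x‖ ≤
      Real.sqrt (|γs| * (1 + |γ|)) / Real.sqrt α * ‖x‖ := by
    intro x
    rw [comp_apply, ← norm_borelFC_sqrt, ← mul_apply_eq_comp,
      ← borelFC_mul hS (isBddBorelOn_sqrt _) hqB]
    refine norm_borelFC_apply_le hS ((isBddBorelOn_sqrt _).mul hqB) (by positivity)
      (fun t ht => ?_) x
    rcases ht.1.eq_or_lt with rfl | h
    · simp only [Real.sqrt_zero, zero_mul, abs_zero]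
      positivity
    -- `t q² = |q| |t q|` is at most `(γs / α) (1 + γ)`
    have hta := ht.2.trans ha
    have h1 := hq.bound α hα hαa t h hta
    have h2 := hq.residual α hα hαa t h hta
    have h3 : |t * q α t| ≤ 1 + |γ| := by
      have h4 := abs_sub 1 (1 - t * q α t)
      rw [sub_sub_cancel, abs_one] at h4
      linarith [le_abs_self γ]
    rw [← Real.sqrt_div (by positivity)]
    refine Real.le_sqrt_of_sq_le ?_
    rw [sq_abs, mul_pow, Real.sq_sqrt ht.1]
    calc t * q α t ^ 2 = |q α t| * |t * q α t| := by
          rw [abs_mul, abs_of_pos h, ← sq_abs]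
          ring
      _ ≤ (|γs| / α) * (1 + |γ|) := by
          refine mul_le_mul (h1.trans ?_) h3 (abs_nonneg _) (by positivity)
          gcongr
          exact le_abs_self γs
      _ = _ := by ring
  have h5 := norm_adjoint_apply_le (by positivity) hb y
  rwa [adjoint_comp, adjoint_borelFC hS hqB] at h5

/-- A qualification `ρ` that covers `Φ` bounds the residual on `Φ`. -/
theorem abs_residual_mul_le {q : ℝ → ℝ → ℝ} {a γ γs α t : ℝ} {Φ ρ : ℝ → ℝ}
    (hq : IsRegularization q a γ γs) (hρ : HasQualification q ρ a γ)
    (hΦ : MonotoneOn Φ (Set.Ici 0)) (hΦ0 : Φ 0 = 0)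
    (hanti : AntitoneOn (fun t => Φ t / ρ t) (Set.Ioc 0 a)) (hα : 0 < α) (hαa : α ≤ a)
    (ht : 0 ≤ t) (hta : t ≤ a) : |Φ t * (1 - t * q α t)| ≤ |γ| * Φ α := by
  have hnn : ∀ s, 0 ≤ s → 0 ≤ Φ s := fun s hs => hΦ0 ▸ hΦ Set.self_mem_Ici hs hs
  have hΦα := hnn α hα.le
  rcases ht.eq_or_lt with rfl | h
  · rw [hΦ0, zero_mul, abs_zero]
    positivity
  have hΦt := hnn t ht
  rw [abs_mul, abs_of_nonneg hΦt]
  rcases le_total t α with hle | hle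
  · have h1 := (hq.residual α hα hαa t h hta).trans (le_abs_self γ)
    rw [mul_comm]
    exact mul_le_mul h1 (hΦ ht hα.le hle) hΦt (abs_nonneg _)
  · have h1 : Φ t / ρ t ≤ Φ α / ρ α := hanti ⟨hα, hαa⟩ ⟨h, hta⟩ hle
    have h2 := hρ.pos t h hta
    have h3 := hρ.pos α hα hαa
    have h4 := hρ.bound α hα hαa t h hta
    calc Φ t * |1 - t * q α t| = Φ t / ρ t * (|1 - t * q α t| * ρ t) := by field_simp
      _ ≤ Φ α / ρ α * (γ * ρ α) :=
          mul_le_mul h1 h4 (by positivity) (by positivity)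
      _ = γ * Φ α := by field_simp
      _ ≤ |γ| * Φ α := mul_le_mul_of_nonneg_right (le_abs_self γ) hΦα

/-- The common form of the two regimes: the lower lifting estimate with exponent `μ` and
constant `c` controls all `φ ≺ Θ^μ`. -/
theorem norm_sub_regSolution_le {A : X →L[𝕜] Y} {E : Y →L[𝕜] Z} {φ ψ ρ : ℝ → ℝ}
    {q : ℝ → ℝ → ℝ} {a γ γs μ c : ℝ}
    (ha : ‖(adjoint (preOp A E)).comp (preOp A E)‖ ≤ a) (hq : IsRegularization q a γ γs)
    (hρ : HasQualification q ρ a γ) (hφ : IsIndexFunction φ) (hψ : IsIndexFunction ψ)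
    (hμ : 0 < μ) (hc : 0 < c) (hc1 : c ≤ 1)
    (hlow : ∀ w, c * ‖borelFC ((adjoint A).comp A) (fun t => Theta ψ t ^ μ) w‖ ≤
      ‖borelFC ((adjoint (preOp A E)).comp (preOp A E)) (fun t => t ^ (μ / 2)) w‖)
    (hprec : Prec φ (fun t => Theta ψ t ^ μ))
    (hanti : AntitoneOn (fun t => φ (f0 ψ t ^ 2) / ρ t) (Set.Ioc 0 a))
    {f : X} {ζ : Z} {δ α : ℝ} (hf : f ∈ sourceSet A φ) (hζ : ‖adjoint E ζ‖ ≤ 1) (hδ : 0 ≤ δ)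
    (hα : 0 < α) (hαa : α ≤ a) :
    ‖f - regSolution A E q α (noisyData A E f δ ζ)‖ ≤
      (2 * |γ| / c + Real.sqrt (|γs| * (1 + |γ|)) + 1) * (φ (f0 ψ α ^ 2) + δ / Real.sqrt α) := by
  set T := preOp A E with hT
  set Φ : ℝ → ℝ := fun t => φ (f0 ψ t ^ 2) with hΦ
  have hS := isPositive_adjoint_comp_self T
  have hG := isPositive_adjoint_comp_self A
  have hqB := hq.isBddBorelOn hα hαa ha
  have hΦmono : MonotoneOn Φ (Set.Ici 0) := phi_f0_monotoneOn hφ hψ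
  have hΦ0 : Φ 0 = 0 := by simp only [hΦ]; rw [f0_zero_sq hψ, hφ.zero]
  have hΦα : 0 ≤ Φ α := hφ.nonneg (sq_nonneg _)
  have hΦB : IsBddBorelOn ‖(adjoint T).comp T‖ Φ := .of_monotoneOn hΦmono
  have hφB := hφ.isBddBorelOn ‖(adjoint A).comp A‖
  have hr : IsBddBorelOn ‖(adjoint T).comp T‖ (fun t => 1 - t * q α t) :=
    (IsBddBorelOn.const 1).sub
      (IsBddBorelOn.mul (.of_continuousOn continuous_id.continuousOn) hqB)
  -- the adjoint `φ(A*A) r(T*T)` of the residual on the source set is estimated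
  have hb : ∀ x, ‖((borelFC ((adjoint A).comp A) φ).comp
      (borelFC ((adjoint T).comp T) (fun t => 1 - t * q α t))) x‖ ≤
        2 / c * (|γ| * Φ α) * ‖x‖ := by
    intro x
    rw [comp_apply, mul_assoc]
    refine (norm_borelFC_le_of_prec hG hS hφ hψ hμ hprec hc hc1 hlow _).trans ?_
    refine mul_le_mul_of_nonneg_left ?_ (by positivity)
    rw [← mul_apply_eq_comp, ← borelFC_mul hS hΦB hr]
    exact norm_borelFC_apply_le hS (hΦB.mul hr) (by positivity) (fun t ht =>
      abs_residual_mul_le hq hρ hΦmono hΦ0 hanti hα hαa ht.1 (ht.2.trans ha)) x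
  obtain ⟨w, hw, rfl⟩ := hf
  have h1 := norm_adjoint_apply_le (by positivity) hb w
  rw [adjoint_comp, adjoint_borelFC hS hr, adjoint_borelFC hG hφB, comp_apply] at h1
  have h2 := norm_borelFC_adjoint_apply_le ha hq hα hαa (adjoint E ζ)
  set C₂ := Real.sqrt (|γs| * (1 + |γ|)) with hC₂
  rw [sub_regSolution_eq hqB]
  refine (norm_sub_le _ _).trans ?_
  rw [norm_smul, RCLike.norm_ofReal, abs_of_nonneg hδ]
  have h3 : 2 / c * (|γ| * Φ α) * ‖w‖ ≤ 2 * |γ| / c * Φ α := by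
    calc _ ≤ 2 / c * (|γ| * Φ α) * 1 := mul_le_mul_of_nonneg_left hw (by positivity)
      _ = _ := by ring
  have h4 : δ * (C₂ / Real.sqrt α * ‖adjoint E ζ‖) ≤ C₂ * (δ / Real.sqrt α) := by
    calc _ ≤ δ * (C₂ / Real.sqrt α * 1) := by gcongr
      _ = _ := by ring
  have h5 := mul_le_mul_of_nonneg_left h2 hδ
  have h6 : 0 ≤ δ / Real.sqrt α := by positivity
  have h7 : 0 ≤ 2 * |γ| / c := by positivity
  have h8 : 0 ≤ C₂ := Real.sqrt_nonneg _
  have h9 := mul_nonneg h7 h6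
  have h10 := mul_nonneg h8 hΦα
  have h11 : (2 * |γ| / c + C₂ + 1) * (Φ α + δ / Real.sqrt α) = 2 * |γ| / c * Φ α +
      C₂ * (δ / Real.sqrt α) + 2 * |γ| / c * (δ / Real.sqrt α) + C₂ * Φ α +
      (Φ α + δ / Real.sqrt α) := by ring
  rw [h11]
  linarith

end ErrorBound

end

/-! ### The convergence rates -/

theorem theorem1 (𝕜 : Type u₀) [RCLike 𝕜] (γ γs m M : ℝ) :
    -- First regime; the constant depends only on `γ`, `γs` and the link constants `m`, `M`.
    (∃ C : ℝ, 0 < C ∧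
      ∀ (X : Type u₁) [NormedAddCommGroup X] [InnerProductSpace 𝕜 X] [CompleteSpace X]
        (Y : Type u₂) [NormedAddCommGroup Y] [InnerProductSpace 𝕜 Y] [CompleteSpace Y]
        (Z : Type u₃) [NormedAddCommGroup Z] [InnerProductSpace 𝕜 Z] [CompleteSpace Z]
        (A : X →L[𝕜] Y) (E : Y →L[𝕜] Z) (φ ψ ρ : ℝ → ℝ) (q : ℝ → ℝ → ℝ) (a : ℝ),
        ‖(ContinuousLinearMap.adjoint (preOp A E)).comp (preOp A E)‖ ≤ a →
        IsRegularization q a γ γs →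
        HasQualification q ρ a γ →
        IsIndexFunction φ →
        LinkCondition A E ψ m M →
        Prec (fun _ => 1) φ →
        Prec φ (Theta ψ) →
        AntitoneOn (fun t => φ (f0 ψ t ^ 2) / ρ t) (Set.Ioc 0 a) →
        ∀ (f : X) (ζ : Z) (δ α : ℝ),
          f ∈ sourceSet A φ →
          ‖ContinuousLinearMap.adjoint E ζ‖ ≤ 1 →
          0 ≤ δ → 0 < α → α ≤ a →
          ‖f - regSolution A E q α (noisyData A E f δ ζ)‖ ≤
            C * (φ (f0 ψ α ^ 2) + δ / Real.sqrt α)) ∧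
    -- Second regime; the constant depends only on `γ`, `γs` and the lifting data `μ`, `m`, `M`.
    (∀ μ : ℝ, ∃ C : ℝ, 0 < C ∧
      ∀ (X : Type u₁) [NormedAddCommGroup X] [InnerProductSpace 𝕜 X] [CompleteSpace X]
        (Y : Type u₂) [NormedAddCommGroup Y] [InnerProductSpace 𝕜 Y] [CompleteSpace Y]
        (Z : Type u₃) [NormedAddCommGroup Z] [InnerProductSpace 𝕜 Z] [CompleteSpace Z]
        (A : X →L[𝕜] Y) (E : Y →L[𝕜] Z) (φ ψ ρ : ℝ → ℝ) (q : ℝ → ℝ → ℝ) (a : ℝ),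
        ‖(ContinuousLinearMap.adjoint (preOp A E)).comp (preOp A E)‖ ≤ a →
        IsRegularization q a γ γs →
        HasQualification q ρ a γ →
        IsIndexFunction φ →
        (∃ m₀ M₀ : ℝ, LinkCondition A E ψ m₀ M₀) →
        LiftingCondition A E ψ μ m M →
        Prec (Theta ψ) φ →
        Prec φ (fun t => Theta ψ t ^ μ) →
        AntitoneOn (fun t => φ (f0 ψ t ^ 2) / ρ t) (Set.Ioc 0 a) →
        ∀ (f : X) (ζ : Z) (δ α : ℝ),
          f ∈ sourceSet A φ →
          ‖ContinuousLinearMap.adjoint E ζ‖ ≤ 1 →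
          0 ≤ δ → 0 < α → α ≤ a →
          ‖f - regSolution A E q α (noisyData A E f δ ζ)‖ ≤
            C * (φ (f0 ψ α ^ 2) + δ / Real.sqrt α)) := by
  -- absolute values keep the constants positive for the parameters that the hypotheses exclude
  refine ⟨⟨2 * |γ| / |m| + Real.sqrt (|γs| * (1 + |γ|)) + 1, by positivity, ?_⟩,
    fun μ => ⟨2 * |γ| / |m ^ μ| + Real.sqrt (|γs| * (1 + |γ|)) + 1, by positivity, ?_⟩⟩
  · intro X _ _ _ Y _ _ _ Z _ _ _ A E φ ψ ρ q a ha hq hρ hφ hlink _ hprec hanti f ζ δ α hf hζ hδ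
      hα hαa
    rw [abs_of_pos hlink.m_pos]
    refine norm_sub_regSolution_le ha hq hρ hφ hlink.index one_pos hlink.m_pos hlink.m_le
      (fun w => ?_) ?_ hanti hf hζ hδ hα hαa
    · simp only [Real.rpow_one, ← Real.sqrt_eq_rpow]
      exact hlink.le_norm_sqrt w
    · simpa only [Real.rpow_one] using hprec
  · intro X _ _ _ Y _ _ _ Z _ _ _ A E φ ψ ρ q a ha hq hρ hφ hlink hlift _ hprec hanti f ζ δ α hf
      hζ hδ hα hαa
    obtain ⟨m₀, M₀, hlink⟩ := hlink
    have hμ : 0 < μ := one_pos.trans hlift.one_lt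
    have hc : 0 < m ^ μ := Real.rpow_pos_of_pos hlift.m_pos μ
    rw [abs_of_pos hc]
    exact norm_sub_regSolution_le ha hq hρ hφ hlink.index hμ hc
      (Real.rpow_le_one hlift.m_pos.le hlift.m_le hμ.le) hlift.lower hprec hanti hf hζ hδ hα hαa
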